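/- Call a finite group $G$ \emph{semiprime-cyclic} if every subgroup $H \subseteq G$ whose order is a product $pq$ of two primes (with $p = q$ allowed) is cyclic. Call $G$ \emph{freely representable} if there are a nonzero complex vector space $V$ and a linear action of $G$ on $V$ such that $gv \neq v$ for every $g \in G$ with $g \neq 1$ and every nonzero $v \in V$. Theorem. Let $G$ be a finite solvable group. Then $G$ is semiprime-cyclic if and only if $G$ is freely representable. -/

import Mathlib

/-- A linear representation of `G` on `V` is free if `V ≠ 0` and no nonidentity element of `G`
fixes a nonzero vector of `V`. -/
def IsFreeRepresentation {F G V : Type*} [Field F] [Group G] [AddCommGroup V] [Module F V]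
    (ρ : Representation F G V) : Prop :=
  Nontrivial V ∧ ∀ g : G, g ≠ 1 → ∀ v : V, v ≠ 0 → ρ g v ≠ v

universe w

/-- `G` is freely representable over `F` if it has a free linear representation on some `F`-vector
space (in a universe `w` that may be chosen at will; no dimension restriction). -/
def IsFreelyRepresentableOver (F G : Type*) [Field F] [Group G] : Prop :=
  ∃ (V : Type w) (_ : AddCommGroup V) (_ : Module F V) (ρ : Representation F G V),
    IsFreeRepresentation ρ

/-- Freely representable, with no field specified, means over the complex numbers. -/
def IsFreelyRepresentable (G : Type*) [Group G] : Prop :=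
  IsFreelyRepresentableOver.{w} ℂ G

/-- `G` is semiprime-cyclic if every subgroup whose order is a product of two primes
(not necessarily distinct) is cyclic. -/
def IsSemiprimeCyclic (G : Type*) [Group G] : Prop :=
  ∀ H : Subgroup G, (∃ p q : ℕ, p.Prime ∧ q.Prime ∧ Nat.card H = p * q) → IsCyclic H

/-! In a free representation the sum of `ρ g v` over a nontrivial subgroup is fixed by that
subgroup, hence zero. In a noncyclic subgroup of order `p * q` the nonidentity elements are
partitioned by the subgroups of prime order. Summing over the whole subgroup and over the pieces
gives `-v` and `-v` times the number of pieces, so there is only one piece: a contradiction.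

Conversely, induct on the order. Solvability yields a normal subgroup `M` of prime index `p`, which
has a free representation. If `M` contains all elements of prime order, coinduction finishes.
Otherwise some `g ∉ M` has order `p`, the order of `M` is prime to `p`, and `G` is a semidirect
product of `M` and `⟨g⟩`. It then suffices to find an operator `T` with `T ^ p = 1`, without fixed
vectors, that induces on `ρ` the automorphism `σ` given by conjugation by `g`.

Since subgroups of order `p * q` are cyclic, `σ` fixes pointwise every subgroup of prime order that
it stabilizes. A study of coprime automorphisms (`IsSemiprimeCyclic.eq_one_or_quaternion`) shows
that either `σ = 1`, and a scalar root of unity serves as `T`; or `p = 3` and `M` is the product of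
a quaternion group, whose units `i, j, k` are rotated by `σ`, and elements that centralize it and
are fixed by `σ`. In that case `T = -(1 + i + j + k) / 2` works
(`QuaternionTriple.exists_operator`). -/

open Module

/-! ### Free representations: coinduction and the necessity of semiprime-cyclicity -/

section Representations

/-- An element of a finite group different from `1` has a power of prime order. -/
theorem exists_prime_orderOf_pow {G : Type*} [Group G] [Finite G] {g : G} (hg : g ≠ 1) :
    ∃ n : ℕ, (orderOf (g ^ n)).Prime := by
  have h1 : orderOf g ≠ 1 := fun h => hg (orderOf_eq_one_iff.mp h)
  obtain ⟨p, hp, m, hm⟩ := Nat.exists_prime_and_dvd h1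
  refine ⟨m, ?_⟩
  have hm0 : m ≠ 0 := by
    rintro rfl
    exact (orderOf_pos g).ne' (by simpa using hm)
  rw [orderOf_pow_of_dvd hm0 ⟨p, by rw [hm, mul_comm]⟩, hm, Nat.mul_div_cancel _ (Nat.pos_of_ne_zero hm0)]
  exact hp

/-- Freeness needs to be checked only on elements of prime order. -/
theorem isFreeRepresentation_of_prime_orderOf {F G V : Type*} [Field F] [Group G] [Finite G]
    [AddCommGroup V] [Module F V] [Nontrivial V] (ρ : Representation F G V)
    (h : ∀ g : G, (orderOf g).Prime → ∀ v : V, ρ g v = v → v = 0) :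
    IsFreeRepresentation ρ := by
  refine ⟨inferInstance, fun g hg v hv hgv => hv ?_⟩
  obtain ⟨n, hn⟩ := exists_prime_orderOf_pow hg
  refine h _ hn v ?_
  clear hn
  induction n with
  | zero => simp
  | succ n ih => rw [pow_succ, map_mul, Module.End.mul_apply, hgv, ih]

/-- If a finite normal subgroup contains all elements of prime order, then a free representation
of the subgroup coinduces to a free representation of the group. -/
theorem IsFreeRepresentation.coind {F G V : Type*} [Field F] [Group G] [Finite G]
    [AddCommGroup V] [Module F V] {M : Subgroup G} [M.Normal] {ρ : Representation F M V}
    (hρ : IsFreeRepresentation ρ) (hM : ∀ g : G, (orderOf g).Prime → g ∈ M) :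
    IsFreeRepresentation (Representation.coind M.subtype ρ) := by
  classical
  obtain ⟨hV, hfree⟩ := hρ
  have : Nontrivial (Representation.coindV M.subtype ρ) := by
    obtain ⟨v, hv⟩ := exists_ne (0 : V)
    let f : G → V := fun x => if hx : x ∈ M then ρ ⟨x, hx⟩ v else 0
    have hf : ∀ (x : G) (hx : x ∈ M), f x = ρ ⟨x, hx⟩ v := fun x hx => dif_pos hx
    have hf0 : ∀ x ∉ M, f x = 0 := fun x hx => dif_neg hx
    refine ⟨⟨⟨f, ?_⟩, 0, ?_⟩⟩
    · intro m x
      change f (m * x) = ρ m (f x)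
      by_cases hx : x ∈ M
      · rw [hf x hx, hf _ (M.mul_mem m.2 hx), ← Module.End.mul_apply, ← map_mul]
        rfl
      · rw [hf0 x hx, hf0 _ fun h => hx ((M.mul_mem_cancel_left m.2).mp h), map_zero]
    · intro h
      have h1 : f 1 = 0 := congrFun (congrArg Subtype.val h) 1
      have h2 : (⟨1, M.one_mem⟩ : M) = 1 := rfl
      apply hv
      simpa [hf 1 M.one_mem, h2] using h1
  refine isFreeRepresentation_of_prime_orderOf _ fun g hg f hf => ?_
  ext x
  have h1 : f.1 (x * g) = f.1 x := congrFun (congrArg Subtype.val hf) x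
  -- Since `x * g = (x * g * x⁻¹) * x`, equivariance under `M` makes the value of `f` at `x` a fixed
  -- vector of the conjugate `x * g * x⁻¹`, which lies in `M`.
  have hgM : x * g * x⁻¹ ∈ M := ‹M.Normal›.conj_mem g (hM g hg) x
  have h2 := f.2 ⟨_, hgM⟩ x
  simp only [Subgroup.coe_subtype, inv_mul_cancel_right, h1] at h2
  by_contra hne
  refine hfree ⟨_, hgM⟩ ?_ (f.1 x) hne h2.symm
  intro h
  have h3 : x * g * x⁻¹ = 1 := congrArg Subtype.val h
  rw [conj_eq_one_iff] at h3
  rw [h3, orderOf_one] at hg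
  exact Nat.not_prime_one hg

/-- Free representability of a finite group does not depend on the universe of the space. -/
theorem IsFreelyRepresentable.change_universe.{w₁, w₂} {G : Type*} [Group G] [Finite G]
    (h : IsFreelyRepresentable.{w₁} G) : IsFreelyRepresentable.{w₂} G := by
  obtain ⟨V, _, _, ρ, hV, hρ⟩ := h
  obtain ⟨v, hv⟩ := exists_ne (0 : V)
  -- The span of one orbit is invariant and finite-dimensional, so it has a coordinate model in
  -- every universe.
  let W : Submodule ℂ V := Submodule.span ℂ (Set.range fun g => ρ g v)
  have hW : ∀ g, W ≤ W.comap (ρ g) := by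
    intro g
    rw [Submodule.span_le]
    rintro _ ⟨x, rfl⟩
    refine Submodule.subset_span ⟨g * x, ?_⟩
    simp
  have : FiniteDimensional ℂ W := FiniteDimensional.span_of_finite ℂ (Set.finite_range _)
  let b := Module.finBasis ℂ W
  let e : W ≃ₗ[ℂ] ULift.{w₂} (Fin (finrank ℂ W) → ℂ) := b.equivFun.trans ULift.moduleEquiv.symm
  let σ : Representation ℂ G W :=
    { toFun := fun g => (ρ g).restrict (hW g)
      map_one' := by ext; simp
      map_mul' := fun x y => by ext; simp }
  let τ : Representation ℂ G (ULift.{w₂} (Fin (finrank ℂ W) → ℂ)) :=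
    { toFun := fun g => e.conj (σ g)
      map_one' := by rw [map_one]; ext; simp [LinearEquiv.conj_apply]
      map_mul' := fun x y => by rw [map_mul]; ext; simp [LinearEquiv.conj_apply] }
  refine ⟨_, _, _, τ, ?_, fun g hg x hx h => ?_⟩
  · have hvW : v ∈ W := Submodule.subset_span ⟨1, by simp⟩
    have : Nontrivial W := ⟨⟨⟨v, hvW⟩, 0, fun h => hv (congrArg Subtype.val h)⟩⟩
    exact e.injective.nontrivial
  · have h1 : σ g (e.symm x) = e.symm x := by
      apply e.injective
      simpa [τ, LinearEquiv.conj_apply] using h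
    refine hρ g hg (e.symm x : W) ?_ (congrArg Subtype.val h1)
    simpa using hx

/-- A finite group that has a noncyclic subgroup whose order is a product of two primes is not
freely representable. -/
theorem IsFreelyRepresentable.isSemiprimeCyclic {G : Type*} [Group G] [Finite G]
    (h : IsFreelyRepresentable.{w} G) : IsSemiprimeCyclic G := by
  classical
  obtain ⟨V, _, _, ρ, hV, hρ⟩ := h
  rintro H ⟨p, q, hp, hq, hcard⟩
  by_contra hH
  obtain ⟨v, hv⟩ := exists_ne (0 : V)
  have := Fintype.ofFinite G
  have hsum : ∀ P : Subgroup G, P ≠ ⊥ → ∑ g : G with g ∈ P, ρ g v = 0 := by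
    intro P hP
    obtain ⟨x, hxP, hx1⟩ := P.bot_or_exists_ne_one.resolve_left hP
    by_contra hne
    refine hρ x hx1 _ hne ?_
    rw [map_sum]
    refine Finset.sum_bij (fun g _ => x * g) ?_ ?_ ?_ ?_
    · intro g hg
      simp only [Finset.mem_filter_univ] at hg ⊢
      exact P.mul_mem hxP hg
    · intro a _ b _ hab
      exact mul_left_cancel hab
    · intro b hb
      simp only [Finset.mem_filter_univ] at hb
      exact ⟨x⁻¹ * b, by simpa using P.mul_mem (P.inv_mem hxP) hb, by simp⟩
    · intro g _
      simp
  have hsum' : ∀ P : Subgroup G, P ≠ ⊥ → ∑ g : G with g ∈ P ∧ g ≠ 1, ρ g v = -v := by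
    intro P hP
    have h1 := hsum P hP
    rw [← Finset.add_sum_erase _ _ (a := (1 : G)) (by simp [P.one_mem])] at h1
    have h2 : ({g : G | g ∈ P ∧ g ≠ 1} : Finset G) = ({g : G | g ∈ P} : Finset G).erase 1 := by
      ext; simp [and_comm]
    rw [h2]
    simp only [map_one, Module.End.one_apply] at h1
    exact (neg_eq_of_add_eq_zero_right h1).symm
  -- No element of `H` has order `p * q`, so every nonidentity element has prime order; the cyclic
  -- subgroups in `T` below therefore partition `H` without `1`.
  have hcyc : ∀ x ∈ H, x ≠ 1 → (Nat.card (Subgroup.zpowers x)).Prime := by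
    intro x hx hx1
    have hd : orderOf x ∣ p * q := by
      rw [← hcard]
      exact Subgroup.orderOf_dvd_natCard H hx
    rw [Nat.card_zpowers]
    have hne : orderOf x ≠ p * q := by
      intro h
      apply hH
      refine isCyclic_of_orderOf_eq_card (⟨x, hx⟩ : H) ?_
      rw [Subgroup.orderOf_mk, h, hcard]
    have h1 : orderOf x ≠ 1 := fun h => hx1 (orderOf_eq_one_iff.mp h)
    obtain ⟨a, b, ha, hb, hab⟩ := (Nat.dvd_mul).mp hd
    rcases (Nat.dvd_prime hp).mp ha with rfl | rfl <;> rcases (Nat.dvd_prime hq).mp hb with rfl | rfl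
    · exact absurd hab.symm (by simpa using h1)
    · rw [← hab]; simpa using hq
    · rw [← hab]; simpa using hp
    · exact absurd hab.symm hne
  have hHbot : H ≠ ⊥ := by
    rintro rfl
    exact hH inferInstance
  let T : Finset (Subgroup G) :=
    ({g : G | g ∈ H ∧ g ≠ 1} : Finset G).image fun g => Subgroup.zpowers g
  have hfib : ∑ g : G with g ∈ H ∧ g ≠ 1, ρ g v = ∑ P ∈ T, -v := by
    rw [← Finset.sum_fiberwise_of_maps_to (t := T) (g := fun g => Subgroup.zpowers g)
      fun g hg => Finset.mem_image_of_mem _ hg]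
    refine Finset.sum_congr rfl fun P hP => ?_
    obtain ⟨x, hx, rfl⟩ := Finset.mem_image.mp hP
    simp only [Finset.mem_filter_univ] at hx
    rw [← hsum' (Subgroup.zpowers x) (by simpa using hx.2)]
    refine Finset.sum_congr ?_ fun _ _ => rfl
    ext g
    simp only [Finset.mem_filter, Finset.mem_univ, true_and]
    constructor
    · rintro ⟨⟨_, h1⟩, h2⟩
      exact ⟨h2 ▸ Subgroup.mem_zpowers g, h1⟩
    · rintro ⟨h1, h2⟩
      have hle : Subgroup.zpowers g ≤ Subgroup.zpowers x := by simpa using h1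
      have hgH : g ∈ H := (by simpa using hx.1 : Subgroup.zpowers x ≤ H) h1
      refine ⟨⟨hgH, h2⟩, Subgroup.eq_of_le_of_card_ge hle ?_⟩
      have hdvd := Subgroup.card_dvd_of_le hle
      exact (((Nat.prime_dvd_prime_iff_eq (hcyc g hgH h2) (hcyc x hx.1 hx.2)).mp hdvd)).ge
  rw [hsum' H hHbot, Finset.sum_const, smul_neg, neg_inj] at hfib
  have hT : T.card = 1 := by
    have h1 : ((T.card : ℂ) - 1) • v = 0 := by
      rw [sub_smul, one_smul, Nat.cast_smul_eq_nsmul, ← hfib, sub_self]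
    rcases smul_eq_zero.mp h1 with h2 | h2
    · exact_mod_cast sub_eq_zero.mp h2
    · exact absurd h2 hv
  obtain ⟨P, hP⟩ := Finset.card_eq_one.mp hT
  obtain ⟨x, hxH, hx1⟩ := H.bot_or_exists_ne_one.resolve_left hHbot
  have hall : ∀ g ∈ H, g ∈ Subgroup.zpowers x := by
    intro g hg
    by_cases hg1 : g = 1
    · rw [hg1]; exact Subgroup.one_mem _
    have hm : ∀ y ∈ H, y ≠ 1 → Subgroup.zpowers y = P := fun y hy hy1 => by
      have : Subgroup.zpowers y ∈ T := Finset.mem_image_of_mem _ (by simp [hy, hy1])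
      simpa [hP] using this
    rw [hm x hxH hx1, ← hm g hg hg1]
    exact Subgroup.mem_zpowers g
  apply hH
  have hHx : H = Subgroup.zpowers x :=
    le_antisymm hall (by simpa using hxH)
  rw [hHx]
  infer_instance

end Representations

/-! ### Extending a free representation across a complement of prime order -/

section Extension

/-- Extending a free representation of a normal subgroup `M` of prime index `p` prime to `|M|`:
an element `g` of order `p` outside `M` acts by an operator that is compatible with the conjugation
by `g` and has no fixed vectors. -/
theorem IsFreeRepresentation.isFreelyRepresentable_of_extension {G : Type*} {V : Type w}
    [Group G] [Finite G] [AddCommGroup V] [Module ℂ V] {M : Subgroup G} [M.Normal]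
    {ρ : Representation ℂ M V} (hρ : IsFreeRepresentation ρ) {p : ℕ} (hp : p.Prime)
    (hindex : M.index = p) (hpM : ¬ p ∣ Nat.card M) {g : G} (hg : orderOf g = p)
    {T : Module.End ℂ V} (hT : T ^ p = 1) (hfix : ∀ v, T v = v → v = 0)
    (hconj : ∀ m : M, T * ρ m = ρ (MulAut.conjNormal g m) * T) :
    IsFreelyRepresentable.{w} G := by
  have := Fact.mk hp
  have hV : Nontrivial V := hρ.1
  have hcardG : Nat.card G = p * Nat.card M := by
    rw [← hindex, mul_comm, Subgroup.card_mul_index]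
  have hcop : (Nat.card M).Coprime (Nat.card (Subgroup.zpowers g)) := by
    rw [Nat.card_zpowers, hg, Nat.coprime_comm, hp.coprime_iff_not_dvd]
    exact hpM
  have hcompl : M.IsComplement' (Subgroup.zpowers g) := by
    refine Subgroup.isComplement'_of_coprime ?_ hcop
    rw [Nat.card_zpowers, hg, hcardG, mul_comm]
  let t : (Module.End ℂ V)ˣ := Units.ofPowEqOne T p hT hp.ne_zero
  have ht : (t : Module.End ℂ V) = T := rfl
  have htp : t ^ p = 1 := Units.pow_ofPowEqOne hT hp.ne_zero
  let r : M →* (Module.End ℂ V)ˣ := ρ.toHomUnits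
  have hr : ∀ m, (r m : Module.End ℂ V) = ρ m := fun m => rfl
  have hgen : ∀ x : Subgroup.zpowers g,
      x ∈ Subgroup.zpowers (⟨g, Subgroup.mem_zpowers g⟩ : Subgroup.zpowers g) := by
    rintro ⟨_, n, rfl⟩
    exact ⟨n, by ext; simp⟩
  let s : Subgroup.zpowers g →* (Module.End ℂ V)ˣ :=
    monoidHomOfForallMemZpowers hgen (g' := t) (by
      rw [Subgroup.orderOf_mk, hg]
      exact orderOf_dvd_of_pow_eq_one htp)
  have hs : s ⟨g, Subgroup.mem_zpowers g⟩ = t := monoidHomOfForallMemZpowers_apply_gen hgen _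
  let e := SemidirectProduct.mulEquivSubgroup hcompl
  have hcompat : ∀ k : Subgroup.zpowers g, ∀ m : M,
      r (MulAut.conjNormal (k : G) m) = s k * r m * (s k)⁻¹ := by
    have hgm : ∀ m : M, r (MulAut.conjNormal g m) = t * r m * t⁻¹ := by
      intro m
      rw [eq_mul_inv_iff_mul_eq]
      ext1
      exact (hconj m).symm
    have hgn : ∀ (n : ℤ) (m : M),
        r ((MulAut.conjNormal g ^ n : MulAut M) m) = t ^ n * r m * (t ^ n)⁻¹ := by
      intro n
      induction n with
      | zero => simp
      | succ n ih =>
        intro m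
        rw [zpow_add_one, zpow_add_one, MulAut.mul_apply, ih, hgm]
        group
      | pred n ih =>
        intro m
        have h2 : r ((MulAut.conjNormal g)⁻¹ m) = t⁻¹ * r m * t := by
          have := hgm ((MulAut.conjNormal g)⁻¹ m)
          rw [MulAut.apply_inv_self] at this
          rw [this]; group
        rw [zpow_sub_one, zpow_sub_one, MulAut.mul_apply, ih, h2]
        group
    rintro ⟨_, n, rfl⟩ m
    have hk : (⟨g ^ n, ⟨n, rfl⟩⟩ : Subgroup.zpowers g) = ⟨g, Subgroup.mem_zpowers g⟩ ^ n := by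
      ext; simp
    have := hgn n m
    rw [← map_zpow] at this
    change r (MulAut.conjNormal (g ^ n) m) = s ⟨g ^ n, ⟨n, rfl⟩⟩ * r m * (s ⟨g ^ n, ⟨n, rfl⟩⟩)⁻¹
    rw [this, hk, map_zpow, hs]
  let f : G →* (Module.End ℂ V)ˣ := (SemidirectProduct.lift r s (by
    intro k
    ext1 m
    exact hcompat k m)).comp e.symm.toMonoidHom
  have hfM : ∀ m : M, f m = r m := by
    intro m
    have h1 : e.symm m = SemidirectProduct.inl m := by
      rw [MulEquiv.symm_apply_eq]
      simp [e]
    simp only [f, MonoidHom.comp_apply, MulEquiv.toMonoidHom_eq_coe, MonoidHom.coe_coe, h1,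
      SemidirectProduct.lift_inl]
  have hfg : f g = t := by
    have h1 : e.symm g = SemidirectProduct.inr ⟨g, Subgroup.mem_zpowers g⟩ := by
      rw [MulEquiv.symm_apply_eq]
      simp [e]
    simp only [f, MonoidHom.comp_apply, MulEquiv.toMonoidHom_eq_coe, MonoidHom.coe_coe, h1,
      SemidirectProduct.lift_inr, hs]
  let τ : Representation ℂ G V := (Units.coeHom _).comp f
  have hτM : ∀ m : M, τ m = ρ m := fun m => congrArg Units.val (hfM m)
  have hτg : τ g = T := congrArg Units.val hfg
  have hpow : ∀ (x : G) (v : V), τ x v = v → ∀ n : ℕ, τ (x ^ n) v = v := by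
    intro x v hx n
    induction n with
    | zero => simp
    | succ n ih => rw [pow_succ, map_mul, Module.End.mul_apply, hx, ih]
  refine ⟨V, _, _, τ, isFreeRepresentation_of_prime_orderOf τ fun x hx v hv => ?_⟩
  by_cases hxM : x ∈ M
  · by_contra hv0
    refine hρ.2 ⟨x, hxM⟩ ?_ v hv0 ?_
    · intro h
      have : x = 1 := congrArg Subtype.val h
      rw [this, orderOf_one] at hx
      exact Nat.not_prime_one hx
    · rw [← hτM]; exact hv
  have hxp : orderOf x = p := by
    have h2 : x ^ p ∈ M := by
      rw [← hindex]
      exact M.pow_index_mem x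
    rcases (Nat.coprime_or_dvd_of_prime hx p) with h | h
    -- If the order of `x` were prime to `p`, then `x` would be a power of `x ^ p`, which lies in
    -- `M`.
    · exfalso
      apply hxM
      have : x ∈ Subgroup.zpowers (x ^ p) := by
        rw [mem_zpowers_pow_iff]
        exact h.symm
      exact (by simpa using h2 : Subgroup.zpowers (x ^ p) ≤ M) this
    · exact (Nat.prime_dvd_prime_iff_eq hx hp).mp h
  have hfact : (Nat.card G).factorization p = 1 := by
    rw [hcardG, Nat.factorization_mul hp.ne_zero Nat.card_pos.ne']
    simp [hp.factorization_self, Nat.factorization_eq_zero_of_not_dvd hpM]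
  -- As `p` divides the order of `G` exactly once, `⟨g⟩` and `⟨x⟩` are conjugate Sylow subgroups. So
  -- `g` is a power of a conjugate of `x`, and a vector fixed by `x` is carried to one fixed by `T`.
  let P : Sylow p G := Sylow.ofCard (Subgroup.zpowers g) (by
    rw [Nat.card_zpowers, hg, hfact, pow_one])
  let Q : Sylow p G := Sylow.ofCard (Subgroup.zpowers x) (by
    rw [Nat.card_zpowers, hxp, hfact, pow_one])
  obtain ⟨a, ha⟩ := MulAction.exists_smul_eq G Q P
  have hag : a * x * a⁻¹ ∈ Subgroup.zpowers g := by
    have h1 : a * x * a⁻¹ ∈ ((a • Q : Sylow p G) : Subgroup G) := by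
      rw [Sylow.coe_subgroup_smul]
      exact Subgroup.smul_mem_pointwise_smul x (MulAut.conj a) _ (Subgroup.mem_zpowers x)
    rw [ha] at h1
    exact h1
  have hgx : g ∈ Subgroup.zpowers (a * x * a⁻¹) := by
    have hle : Subgroup.zpowers (a * x * a⁻¹) ≤ Subgroup.zpowers g := by simpa using hag
    have := Subgroup.eq_of_le_of_card_ge hle (by
      rw [Nat.card_zpowers, Nat.card_zpowers, hg, ← hxp]
      exact ((MulAut.conj a).orderOf_eq x).ge)
    rw [this]
    exact Subgroup.mem_zpowers g
  obtain ⟨n, hn⟩ := (mem_powers_iff_mem_zpowers.mpr hgx)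
  have h1 : τ (a * x * a⁻¹) (τ a v) = τ a v := by
    rw [← Module.End.mul_apply, ← map_mul, inv_mul_cancel_right, map_mul, Module.End.mul_apply, hv]
  have h2 := hpow _ _ h1 n
  simp only at hn
  rw [hn, hτg] at h2
  have h3 := hfix _ h2
  have : τ (a⁻¹) (τ a v) = v := by
    rw [← Module.End.mul_apply, ← map_mul, inv_mul_cancel, map_one, Module.End.one_apply]
  rw [← this, h3, map_zero]

end Extension

/-! ### Coprime automorphisms of `q`-groups and minimal moved subgroups -/

section CoprimeAutomorphisms

variable {M : Type*} [Group M]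

theorem MulAut.pow_apply_eq_mul_pow {σ : MulAut M} {x c : M} (hx : σ x = x * c) (hc : σ c = c)
    (k : ℕ) : (σ ^ k) x = x * c ^ k := by
  induction k with
  | zero => simp
  | succ k ih => rw [pow_succ', MulAut.mul_apply, ih, map_mul, map_pow, hx, hc, pow_succ', mul_assoc]

/-- An automorphism of order dividing `n` that translates `x` by a fixed element of order prime
to `n` fixes `x`. -/
theorem MulAut.eq_one_of_apply_eq_mul {σ : MulAut M} {n : ℕ} (hσ : σ ^ n = 1) {x c : M}
    (hx : σ x = x * c) (hc : σ c = c) (hn : (orderOf c).Coprime n) : c = 1 := by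
  have h := MulAut.pow_apply_eq_mul_pow hx hc n
  rw [hσ, MulAut.one_apply, left_eq_mul] at h
  rw [← orderOf_eq_one_iff]
  exact Nat.Coprime.eq_one_of_dvd hn (orderOf_dvd_of_pow_eq_one h)

theorem IsPGroup.coprime_orderOf {q n : ℕ} {H : Subgroup M} (hH : IsPGroup q H)
    (hn : q.Coprime n) {x : M} (hx : x ∈ H) : (orderOf x).Coprime n := by
  obtain ⟨k, hk⟩ := hH ⟨x, hx⟩
  refine Nat.Coprime.coprime_dvd_left (orderOf_dvd_of_pow_eq_one (n := q ^ k) ?_)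
    (Nat.Coprime.pow_left k hn)
  simpa using congrArg Subtype.val hk

/-- The collection formula in class two. When `e ^ q = 1` and `q` divides `n.choose 2`, taking
`n`-th powers becomes multiplicative; this is used for `n = q` odd and for `n = 4`, `q = 2`. -/
theorem mul_pow_of_commutator {a b e : M} (h : b * a = a * b * e) (ha : Commute e a)
    (hb : Commute e b) (n : ℕ) : (a * b) ^ n = a ^ n * b ^ n * e ^ n.choose 2 := by
  have h1 : ∀ n : ℕ, b ^ n * a = a * b ^ n * e ^ n := by
    intro n
    induction n with
    | zero => simp
    | succ n ih =>
      calc b ^ (n + 1) * a = b * (b ^ n * a) := by rw [pow_succ']; group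
        _ = (b * a) * (b ^ n * e ^ n) := by rw [ih]; group
        _ = a * b * (e * b ^ n) * e ^ n := by rw [h]; group
        _ = a * b ^ (n + 1) * e ^ (n + 1) := by
          rw [(hb.pow_right n).eq, pow_succ' b, pow_succ' e]; simp only [mul_assoc]
  induction n with
  | zero => simp
  | succ n ih =>
    have hc : Commute (e ^ n.choose 2) (a * b) := (ha.mul_right hb).pow_left _
    have h2 : (n + 1).choose 2 = n + n.choose 2 := by
      rw [Nat.choose_succ_succ' n 1, Nat.choose_one_right]
    calc (a * b) ^ (n + 1) = a ^ n * b ^ n * (e ^ n.choose 2 * (a * b)) := by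
          rw [pow_succ, ih]; simp only [mul_assoc]
      _ = a ^ n * (b ^ n * a) * b * e ^ n.choose 2 := by rw [hc.eq]; simp only [mul_assoc]
      _ = a ^ n * a * b ^ n * (e ^ n * b) * e ^ n.choose 2 := by rw [h1]; simp only [mul_assoc]
      _ = a ^ (n + 1) * b ^ (n + 1) * e ^ (n + 1).choose 2 := by
        rw [(hb.pow_left n).eq, h2, pow_succ a, pow_succ b, pow_add]; simp only [mul_assoc]

/-- A nontrivial finite `q`-group has a proper subgroup that contains all `q`-th powers and all
commutators. -/
theorem IsPGroup.exists_lt_pow_mem_commutator_mem {q : ℕ} (hq : q.Prime) {H : Subgroup M}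
    [Finite H] (hH : IsPGroup q H) (hne : H ≠ ⊥) :
    ∃ R < H, (∀ x ∈ H, x ^ q ∈ R) ∧ ∀ x ∈ H, ∀ y ∈ H, x * y * x⁻¹ * y⁻¹ ∈ R := by
  have := Fact.mk hq
  obtain ⟨k, hk⟩ := IsPGroup.iff_card.mp hH
  have hk0 : k ≠ 0 := by
    rintro rfl
    exact hne (Subgroup.card_eq_one.mp (by simpa using hk))
  obtain ⟨k, rfl⟩ := Nat.exists_eq_succ_of_ne_zero hk0
  obtain ⟨S, hS⟩ := Sylow.exists_subgroup_card_pow_prime q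
    (show q ^ k ∣ Nat.card H by rw [hk]; exact pow_dvd_pow q k.le_succ)
  have hindex : S.index = q := by
    have := S.card_mul_index
    rw [hS, hk, pow_succ] at this
    exact Nat.eq_of_mul_eq_mul_left (pow_pos hq.pos k) this
  have hnormal : S.Normal := by
    apply Subgroup.normal_of_index_eq_minFac_card
    rw [hindex, hk, hq.pow_minFac k.succ_ne_zero]
  have hcyc : IsCyclic (H ⧸ S) := isCyclic_of_prime_card (p := q) hindex
  refine ⟨S.map H.subtype, ?_, ?_, ?_⟩
  · refine lt_of_le_of_ne (Subgroup.map_subtype_le S) fun h => ?_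
    have h1 : Nat.card (S.map H.subtype) = Nat.card S :=
      Subgroup.card_map_of_injective H.subtype_injective
    rw [h, hS, hk, pow_succ] at h1
    have := hq.one_lt
    have := pow_pos hq.pos k
    nlinarith
  · intro x hx
    refine ⟨⟨x, hx⟩ ^ q, ?_, by simp⟩
    rw [← hindex]
    exact S.pow_index_mem _
  · intro x hx y hy
    refine ⟨⟨x, hx⟩ * ⟨y, hy⟩ * ⟨x, hx⟩⁻¹ * ⟨y, hy⟩⁻¹, ?_, by simp⟩
    have hcomm : ∀ a b : H ⧸ S, a * b = b * a := IsCyclic.commGroup.mul_comm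
    refine (QuotientGroup.eq_one_iff _).mp ?_
    simp only [QuotientGroup.mk_mul, QuotientGroup.mk_inv]
    rw [hcomm (QuotientGroup.mk ⟨x, hx⟩)]
    group

/-- `H` is minimal among the subgroups that `σ` stabilizes but does not fix pointwise. -/
structure MulAut.IsMinimalMoved (σ : MulAut M) (H : Subgroup M) : Prop where
  apply_mem : ∀ x ∈ H, σ x ∈ H
  exists_moved : ∃ x ∈ H, σ x ≠ x
  fixed_of_lt : ∀ N < H, (∀ x ∈ N, σ x ∈ N) → ∀ x ∈ N, σ x = x

theorem MulAut.exists_isMinimalMoved [Finite M] {σ : MulAut M} {Q : Subgroup M}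
    (hQ : ∀ x ∈ Q, σ x ∈ Q) (hne : ∃ x ∈ Q, σ x ≠ x) :
    ∃ H ≤ Q, σ.IsMinimalMoved H := by
  obtain ⟨H, hHQ, hH⟩ := (Set.toFinite
    {H : Subgroup M | (∀ x ∈ H, σ x ∈ H) ∧ ∃ x ∈ H, σ x ≠ x}).exists_le_minimal
    (show Q ∈ _ from ⟨hQ, hne⟩)
  refine ⟨H, hHQ, hH.1.1, hH.1.2, fun N hN hinv x hx => ?_⟩
  by_contra hxx
  exact hN.not_ge (hH.2 (show N ∈ _ from ⟨hinv, x, hx, hxx⟩) hN.le)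

namespace MulAut.IsMinimalMoved

variable {σ : MulAut M} {H : Subgroup M} {q n : ℕ}

/-- If the displacements `x⁻¹ * σ x` generated a proper subgroup, minimality would make them all
fixed. But a coprime automorphism cannot translate `x` by a nontrivial fixed element, so nothing
would move. -/
theorem closure_eq (h : σ.IsMinimalMoved H) (hH : IsPGroup q H) (hn : q.Coprime n)
    (hσ : σ ^ n = 1) : Subgroup.closure {c | ∃ x ∈ H, c = x⁻¹ * σ x} = H := by
  set D := Subgroup.closure {c | ∃ x ∈ H, c = x⁻¹ * σ x} with hD
  have hle : D ≤ H := by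
    rw [hD, Subgroup.closure_le]
    rintro _ ⟨x, hx, rfl⟩
    exact H.mul_mem (H.inv_mem hx) (h.apply_mem x hx)
  by_contra hne
  have hinv : D ≤ D.comap σ.toMonoidHom := by
    conv_lhs => rw [hD]
    rw [Subgroup.closure_le]
    rintro _ ⟨x, hx, rfl⟩
    exact Subgroup.subset_closure ⟨σ x, h.apply_mem x hx, by simp⟩
  obtain ⟨x, hx, hxx⟩ := h.exists_moved
  have hfix := h.fixed_of_lt D (lt_of_le_of_ne hle hne) hinv (x⁻¹ * σ x)
    (Subgroup.subset_closure ⟨x, hx, rfl⟩)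
  have := MulAut.eq_one_of_apply_eq_mul hσ (x := x) (c := x⁻¹ * σ x) (by simp) hfix
    (hH.coprime_orderOf hn (H.mul_mem (H.inv_mem hx) (h.apply_mem x hx)))
  exact hxx (inv_mul_eq_one.mp this).symm

/-- Both `y` and `x * y * x⁻¹` lie in `N` and are fixed; comparing the conjugates of `y` by `x` and
by `σ x` shows that `x⁻¹ * σ x` centralizes `y`. These displacements generate `H`. -/
theorem commute_of_lt (h : σ.IsMinimalMoved H) (hH : IsPGroup q H) (hn : q.Coprime n)
    (hσ : σ ^ n = 1) {N : Subgroup M} (hN : N < H) (hinv : ∀ x ∈ N, σ x ∈ N)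
    (hconj : ∀ x ∈ H, ∀ y ∈ N, x * y * x⁻¹ ∈ N) {y : M} (hy : y ∈ N) {x : M} (hx : x ∈ H) :
    Commute y x := by
  have hle : H ≤ Subgroup.centralizer {y} := by
    rw [← h.closure_eq hH hn hσ, Subgroup.closure_le]
    rintro _ ⟨x, hx, rfl⟩
    rw [SetLike.mem_coe, Subgroup.mem_centralizer_singleton_iff]
    have h1 := h.fixed_of_lt N hN hinv _ (hconj x hx y hy)
    rw [map_mul, map_mul, map_inv, h.fixed_of_lt N hN hinv y hy] at h1
    calc x⁻¹ * σ x * y = x⁻¹ * (σ x * y * (σ x)⁻¹) * σ x := by group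
      _ = y * (x⁻¹ * σ x) := by rw [h1]; group
  exact (Subgroup.mem_centralizer_singleton_iff.mp (hle hx)).symm

/-- In a minimal moved `q`-group all `q`-th powers and all commutators are central and fixed. -/
theorem exists_central (h : σ.IsMinimalMoved H) [Finite H] (hq : q.Prime) (hH : IsPGroup q H)
    (hn : q.Coprime n) (hσ : σ ^ n = 1) :
    ∃ N : Subgroup M, (∀ y ∈ N, σ y = y) ∧ (∀ y ∈ N, ∀ x ∈ H, Commute y x) ∧
      (∀ x ∈ H, x ^ q ∈ N) ∧ ∀ x ∈ H, ∀ y ∈ H, x * y * x⁻¹ * y⁻¹ ∈ N := by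
  have hne : H ≠ ⊥ := by
    rintro rfl
    obtain ⟨x, hx, hxx⟩ := h.exists_moved
    rw [Subgroup.mem_bot] at hx
    simp [hx] at hxx
  obtain ⟨R, hR, hRpow, hRcomm⟩ := hH.exists_lt_pow_mem_commutator_mem hq hne
  let N := Subgroup.closure {c | (∃ x ∈ H, c = x ^ q) ∨
    ∃ x ∈ H, ∃ y ∈ H, c = x * y * x⁻¹ * y⁻¹}
  have hNR : N ≤ R := by
    rw [Subgroup.closure_le]
    rintro _ (⟨x, hx, rfl⟩ | ⟨x, hx, y, hy, rfl⟩)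
    · exact hRpow x hx
    · exact hRcomm x hx y hy
  have hNH : N < H := lt_of_le_of_lt hNR hR
  have hinv : N ≤ N.comap σ.toMonoidHom := by
    refine (Subgroup.closure_le _).mpr ?_
    rintro _ (⟨x, hx, rfl⟩ | ⟨x, hx, y, hy, rfl⟩)
    · exact Subgroup.subset_closure (Or.inl ⟨σ x, h.apply_mem x hx, by simp⟩)
    · exact Subgroup.subset_closure
        (Or.inr ⟨σ x, h.apply_mem x hx, σ y, h.apply_mem y hy, by simp⟩)
  have hcomm : ∀ x ∈ H, ∀ y ∈ H, x * y * x⁻¹ * y⁻¹ ∈ N := fun x hx y hy =>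
    Subgroup.subset_closure (Or.inr ⟨x, hx, y, hy, rfl⟩)
  have hconj : ∀ x ∈ H, ∀ y ∈ N, x * y * x⁻¹ ∈ N := by
    intro x hx y hy
    have h1 := N.mul_mem (hcomm x hx y (hNH.le hy)) hy
    rwa [inv_mul_cancel_right] at h1
  exact ⟨N, h.fixed_of_lt N hNH hinv,
    fun y hy x hx => h.commute_of_lt hH hn hσ hNH hinv hconj hy hx,
    fun x hx => Subgroup.subset_closure (Or.inl ⟨x, hx, rfl⟩), hcomm⟩

/-- For `a, b` in a minimal moved `q`-group, `b * a = a * b * e` with `e` central of exponent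
`q`. -/
theorem exists_commutator (h : σ.IsMinimalMoved H) [Finite H] (hq : q.Prime) (hH : IsPGroup q H)
    (hn : q.Coprime n) (hσ : σ ^ n = 1) {a b : M} (ha : a ∈ H) (hb : b ∈ H) :
    ∃ e ∈ H, b * a = a * b * e ∧ (∀ x ∈ H, Commute e x) ∧ e ^ q = 1 := by
  obtain ⟨N, -, hcent, hpow, hcomm⟩ := h.exists_central hq hH hn hσ
  have hmem := hcomm b⁻¹ (H.inv_mem hb) a⁻¹ (H.inv_mem ha)
  have he := hcent _ hmem
  have hba : b * a = a * b * (b⁻¹ * a⁻¹ * b⁻¹⁻¹ * a⁻¹⁻¹) := by group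
  have heH : b⁻¹ * a⁻¹ * b⁻¹⁻¹ * a⁻¹⁻¹ ∈ H := by
    simp only [inv_inv]
    exact H.mul_mem (H.mul_mem (H.mul_mem (H.inv_mem hb) (H.inv_mem ha)) hb) ha
  refine ⟨_, heH, hba, he, ?_⟩
  set e := b⁻¹ * a⁻¹ * b⁻¹⁻¹ * a⁻¹⁻¹
  have h1 : ∀ k : ℕ, b ^ k * a = a * b ^ k * e ^ k := by
    intro k
    have h2 : a⁻¹ * b * a = b * e := by rw [mul_assoc, hba]; group
    have h3 : a⁻¹ * b ^ k * a = b ^ k * e ^ k := by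
      rw [← (he b hb).symm.mul_pow, ← h2]
      have := conj_pow (i := k) (a := a⁻¹) (b := b)
      simpa using this.symm
    rw [mul_assoc a, ← h3]; group
  -- Centrality of `b ^ q` forces the factor `e ^ q` to be trivial.
  have h2 := (hcent _ (hpow b hb) a ha).eq
  rw [h1 q] at h2
  simpa using h2

/-- For odd `q` the `q`-th power is multiplicative on the elements involved, and `x ^ q` is fixed,
so `(x⁻¹ * σ x) ^ q = 1`. Then every displacement is fixed, hence trivial. -/
theorem eq_two (h : σ.IsMinimalMoved H) [Finite H] (hq : q.Prime) (hH : IsPGroup q H)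
    (hn : q.Coprime n) (hσ : σ ^ n = 1) (hfix : ∀ x ∈ H, x ^ q = 1 → σ x = x) : q = 2 := by
  by_contra hq2
  obtain ⟨N, hN, -, hpow, -⟩ := h.exists_central hq hH hn hσ
  obtain ⟨x, hx, hxx⟩ := h.exists_moved
  have hc := H.mul_mem (H.inv_mem hx) (h.apply_mem x hx)
  obtain ⟨e, -, he, hecomm, heq⟩ :=
    h.exists_commutator hq hH hn hσ (H.inv_mem hx) (h.apply_mem x hx)
  have h1 := mul_pow_of_commutator he (hecomm _ (H.inv_mem hx)) (hecomm _ (h.apply_mem x hx)) q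
  obtain ⟨k, hk⟩ := hq.dvd_choose_self two_ne_zero (lt_of_le_of_ne hq.two_le (Ne.symm hq2))
  rw [hk, pow_mul, heq, one_pow, mul_one, ← map_pow, hN _ (hpow x hx), inv_pow,
    inv_mul_cancel] at h1
  have := MulAut.eq_one_of_apply_eq_mul hσ (x := x) (c := x⁻¹ * σ x) (by simp) (hfix _ hc h1)
    (hH.coprime_orderOf hn hc)
  exact hxx (inv_mul_eq_one.mp this).symm

/-- Fourth powers are multiplicative, so the solutions of `x ^ 4 = 1` form an invariant subgroup
`Ω`. It contains every displacement, because squares are fixed; if it were proper, all displacements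
would be fixed, hence trivial. -/
theorem pow_four_eq_one (h : σ.IsMinimalMoved H) [Finite H] (hH : IsPGroup 2 H)
    (hn : Nat.Coprime 2 n) (hσ : σ ^ n = 1) {x : M} (hx : x ∈ H) : x ^ 4 = 1 := by
  have hmul : ∀ a ∈ H, ∀ b ∈ H, (a * b) ^ 4 = a ^ 4 * b ^ 4 := by
    intro a ha b hb
    obtain ⟨e, -, he, hecomm, heq⟩ := h.exists_commutator Nat.prime_two hH hn hσ ha hb
    rw [mul_pow_of_commutator he (hecomm a ha) (hecomm b hb) 4,
      show Nat.choose 4 2 = 2 * 3 from rfl, pow_mul, heq, one_pow, mul_one]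
  let Ω : Subgroup M :=
    { carrier := {x | x ∈ H ∧ x ^ 4 = 1}
      one_mem' := ⟨H.one_mem, one_pow 4⟩
      mul_mem' := fun {a b} ha hb =>
        ⟨H.mul_mem ha.1 hb.1, by rw [hmul a ha.1 b hb.1, ha.2, hb.2, mul_one]⟩
      inv_mem' := fun {a} ha => ⟨H.inv_mem ha.1, by rw [inv_pow, ha.2, inv_one]⟩ }
  have hle : Ω ≤ H := fun x hx => hx.1
  suffices Ω = H from (this ▸ hx : x ∈ Ω).2
  by_contra hne
  have hfix := h.fixed_of_lt Ω (lt_of_le_of_ne hle hne) fun x hx =>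
    ⟨h.apply_mem x hx.1, by rw [← map_pow, hx.2, map_one]⟩
  obtain ⟨N, hN, -, hpow, -⟩ := h.exists_central Nat.prime_two hH hn hσ
  obtain ⟨y, hy, hyy⟩ := h.exists_moved
  have hc := H.mul_mem (H.inv_mem hy) (h.apply_mem y hy)
  have h1 : y⁻¹ * σ y ∈ Ω := by
    refine ⟨hc, ?_⟩
    have h4 : y ^ 4 = (y ^ 2) ^ 2 := (pow_mul y 2 2)
    rw [hmul _ (H.inv_mem hy) _ (h.apply_mem y hy), ← map_pow, h4, map_pow, hN _ (hpow y hy),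
      ← h4, inv_pow, inv_mul_cancel]
  have := MulAut.eq_one_of_apply_eq_mul hσ (x := y) (c := y⁻¹ * σ y) (by simp) (hfix _ h1)
    (hH.coprime_orderOf hn hc)
  exact hyy (inv_mul_eq_one.mp this).symm

end MulAut.IsMinimalMoved

end CoprimeAutomorphisms

/-! ### A minimal moved `2`-group with one involution is a quaternion group -/

section QuaternionTriples

variable {M : Type*} [Group M]

/-- A rewriting system that brings words in `x, y, z` to the form `x ^ a * (y ^ b * z ^ c)`. -/
theorem quaternion_rules {x y z : M} (zz : z * z = 1) (zx : z * x = x * z) (zy : z * y = y * z)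
    (xx : x * x = z) (yy : y * y = z) (yx : y * x = x * y * z) :
    z * z = 1 ∧ (∀ t, z * (z * t) = t) ∧ z * x = x * z ∧ (∀ t, z * (x * t) = x * (z * t)) ∧
      z * y = y * z ∧ (∀ t, z * (y * t) = y * (z * t)) ∧ x * x = z ∧ (∀ t, x * (x * t) = z * t) ∧
      y * y = z ∧ (∀ t, y * (y * t) = z * t) ∧ y * x = x * (y * z) ∧
      ∀ t, y * (x * t) = x * (y * (z * t)) := by
  refine ⟨zz, fun t => ?_, zx, fun t => ?_, zy, fun t => ?_, xx, fun t => ?_, yy, fun t => ?_, ?_,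
    fun t => ?_⟩
  · rw [← mul_assoc, zz, one_mul]
  · rw [← mul_assoc, zx, mul_assoc]
  · rw [← mul_assoc, zy, mul_assoc]
  · rw [← mul_assoc, xx]
  · rw [← mul_assoc, yy]
  · rw [yx, mul_assoc]
  · rw [← mul_assoc, yx]; simp only [mul_assoc]

/-- `1, i, j, k` behave as the quaternion units, with `z` in the role of `-1`, and `σ` permutes
`i, j, k` cyclically. -/
structure QuaternionTriple (σ : MulAut M) (z i j k : M) : Prop where
  z_ne : z ≠ 1
  z_sq : z * z = 1
  i_sq : i * i = z
  j_sq : j * j = z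
  i_mul_j : i * j = k
  j_mul_i : j * i = k * z
  map_i : σ i = j
  map_j : σ j = k
  map_k : σ k = i

namespace QuaternionTriple

variable {σ : MulAut M} {z i j k : M}

theorem z_mul_i (h : QuaternionTriple σ z i j k) : z * i = i * z := by
  rw [← h.i_sq, mul_assoc]

theorem z_mul_j (h : QuaternionTriple σ z i j k) : z * j = j * z := by
  rw [← h.j_sq, mul_assoc]

theorem map_z (h : QuaternionTriple σ z i j k) : σ z = z := by
  rw [← h.i_sq, map_mul, h.map_i, h.j_sq, h.i_sq]

theorem rules (h : QuaternionTriple σ z i j k) :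
    z * z = 1 ∧ (∀ t, z * (z * t) = t) ∧ z * i = i * z ∧ (∀ t, z * (i * t) = i * (z * t)) ∧
      z * j = j * z ∧ (∀ t, z * (j * t) = j * (z * t)) ∧ i * i = z ∧ (∀ t, i * (i * t) = z * t) ∧
      j * j = z ∧ (∀ t, j * (j * t) = z * t) ∧ j * i = i * (j * z) ∧
      ∀ t, j * (i * t) = i * (j * (z * t)) :=
  quaternion_rules h.z_sq h.z_mul_i h.z_mul_j h.i_sq h.j_sq (by rw [h.j_mul_i, h.i_mul_j])

theorem pow_three_eq_one_on (h : QuaternionTriple σ z i j k) : (σ ^ 3) i = i := by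
  simp [pow_succ, h.map_i, h.map_j, h.map_k]

end QuaternionTriple

/-- `x` is one of the eight elements `±1, ±i, ±j, ±k`. -/
def IsQuaternionUnit (z i j k x : M) : Prop :=
  ∃ a, (a = 1 ∨ a = i ∨ a = j ∨ a = k) ∧ (x = a ∨ x = a * z)

/-- Squares and commutators lie in `{1, z}`, and an element of square `z` has centralizer `{1, z, x,
x * z}` in `H`. A moved `x` and `y = σ x` cannot commute, so they generate a quaternion group. It is
all of `H`, because each `w` or `w * y` commutes with `x`. -/
theorem MulAut.IsMinimalMoved.exists_quaternionTriple {σ : MulAut M} {H : Subgroup M} {n : ℕ}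
    (h : σ.IsMinimalMoved H) [Finite H] (hH : IsPGroup 2 H) (hn : Nat.Coprime 2 n)
    (hσ : σ ^ n = 1) {z : M} (hzH : z ∈ H) (hz1 : z ≠ 1) (zz : z * z = 1)
    (huniq : ∀ x ∈ H, x * x = 1 → x = 1 ∨ x = z) :
    ∃ i j k, i ∈ H ∧ j ∈ H ∧ k ∈ H ∧ QuaternionTriple σ z i j k ∧
      ∀ x ∈ H, IsQuaternionUnit z i j k x := by
  have hzc : ∀ x ∈ H, z * x = x * z := by
    intro x hx
    rcases huniq (x * z * x⁻¹) (H.mul_mem (H.mul_mem hx hzH) (H.inv_mem hx))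
      (by rw [show x * z * x⁻¹ * (x * z * x⁻¹) = x * (z * z) * x⁻¹ by group, zz]; group) with h1 | h1
    · exact absurd (conj_eq_one_iff.mp h1) hz1
    · rw [mul_inv_eq_iff_eq_mul] at h1
      exact h1.symm
  have hσz : σ z = z := by
    rcases huniq (σ z) (h.apply_mem z hzH) (by rw [← map_mul, zz, map_one]) with h1 | h1
    · exact absurd ((map_eq_one_iff σ σ.injective).mp h1) hz1
    · exact h1
  have hsq : ∀ x ∈ H, x * x = 1 ∨ x * x = z := fun x hx =>
    huniq _ (H.mul_mem hx hx) (by rw [← h.pow_four_eq_one hH hn hσ hx]; simp [pow_succ, mul_assoc])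
  have hcomm : ∀ a ∈ H, ∀ b ∈ H, b * a = a * b ∨ b * a = a * b * z := by
    intro a ha b hb
    obtain ⟨e, heH, he, -, he2⟩ := h.exists_commutator Nat.prime_two hH hn hσ ha hb
    rcases huniq e heH (by rw [← sq, he2]) with rfl | rfl
    · exact Or.inl (by rw [he, mul_one])
    · exact Or.inr he
  have hcent : ∀ a ∈ H, a * a = z → ∀ b ∈ H, b * a = a * b →
      b = 1 ∨ b = z ∨ b = a ∨ b = a * z := by
    intro a ha haz b hb hab
    rcases hsq b hb with h1 | h1
    · rcases huniq b hb h1 with h2 | h2 <;> simp [h2]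
    · have h2 : b * a * (b * a) = 1 := by
        rw [show b * a * (b * a) = b * (a * b) * a by group, ← hab, ← mul_assoc, h1,
          mul_assoc, haz, zz]
      have h3 : a * (a * z) = 1 := by rw [← mul_assoc, haz, zz]
      rcases huniq _ (H.mul_mem hb ha) h2 with h4 | h4
      · right; right; right
        rw [eq_inv_of_mul_eq_one_left h4, eq_inv_of_mul_eq_one_right h3]
      · right; right; left
        rw [← haz] at h4
        exact mul_right_cancel h4
  have h2z : orderOf z = 2 := orderOf_eq_prime (by rw [sq, zz]) hz1
  obtain ⟨x, hx, hxx⟩ := h.exists_moved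
  have hxz : x * x = z := by
    rcases hsq x hx with h1 | h1
    · rcases huniq x hx h1 with rfl | rfl
      · simp at hxx
      · exact absurd hσz hxx
    · exact h1
  obtain ⟨y, hy⟩ : ∃ y, y = σ x := ⟨_, rfl⟩
  have hyH : y ∈ H := hy ▸ h.apply_mem x hx
  have hyz : y * y = z := by rw [hy, ← map_mul, hxz, hσz]
  have hyx : y * x = x * y * z := by
    rcases hcomm x hx y hyH with h1 | h1
    · exfalso
      rcases hcent x hx hxz y hyH h1 with h2 | h2 | h2 | h2
      · rw [h2, one_mul] at hyz; exact hz1 hyz.symm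
      · rw [h2, zz] at hyz; exact hz1 hyz.symm
      · exact hxx (hy.symm.trans h2)
      · exact hz1 (MulAut.eq_one_of_apply_eq_mul hσ (hy.symm.trans h2) hσz (by rwa [h2z]))
    · exact h1
  have R := quaternion_rules zz (hzc x hx) (hzc y hyH) hxz hyz hyx
  have hlist : ∀ w ∈ H, (w = 1 ∨ w = z ∨ w = x ∨ w = x * z) ∨
      (w = y ∨ w = y * z ∨ w = x * y ∨ w = x * (y * z)) := by
    intro w hw
    rcases hcomm x hx w hw with h1 | h1
    · exact Or.inl (hcent x hx hxz w hw h1)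
    · right
      have h2 : w * y * x = x * (w * y) := by
        calc w * y * x = w * (y * x) := mul_assoc ..
          _ = (w * x) * (y * z) := by rw [hyx]; simp only [mul_assoc]
          _ = x * w * (z * (y * z)) := by rw [h1]; simp only [mul_assoc]
          _ = x * (w * y) := by simp only [R, mul_assoc]; simp
      have h3 : w = w * y * (y * z) := by simp only [R, mul_assoc]; simp
      rcases hcent x hx hxz _ (H.mul_mem hw hyH) h2 with h4 | h4 | h4 | h4 <;> rw [h4] at h3 <;>
        (try simp only [R, mul_assoc, one_mul] at h3) <;> simp [h3]
  have hwH := h.apply_mem y hyH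
  have hwz : σ y * σ y = z := by rw [← map_mul, hyz, hσz]
  have hwy : σ y * y = y * σ y * z := by
    have := congrArg σ hyx
    simpa only [map_mul, ← hy, hσz] using this
  -- As `n` is odd, `σ ^ 2` moves `x`, and it cannot translate `x` by the fixed involution either.
  -- This leaves only `x * y` and `x * y * z` for `σ y`.
  have hsq2 : ∀ c, (c = 1 ∨ c = z) → (σ ^ 2) x ≠ x * c := by
    rintro c hc h1
    have hσ2 : (σ ^ 2) ^ n = 1 := by rw [← pow_mul, mul_comm, pow_mul, hσ, one_pow]
    rcases hc with rfl | rfl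
    · rw [mul_one] at h1
      obtain ⟨m, hm⟩ := (Nat.coprime_two_left.mp hn)
      have h2 := MulAut.pow_apply_eq_mul_pow (σ := σ ^ 2) (x := x) (c := 1) (by rw [h1, mul_one])
        (map_one _) m
      rw [one_pow, mul_one] at h2
      have h3 : (σ ^ n) x = x := by rw [hσ]; rfl
      rw [hm, add_comm, pow_add, pow_one, MulAut.mul_apply, pow_mul, h2] at h3
      exact hxx h3
    · refine hz1 (MulAut.eq_one_of_apply_eq_mul hσ2 h1 ?_ (by rwa [h2z]))
      rw [sq, MulAut.mul_apply, hσz, hσz]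
  have hσ2x : (σ ^ 2) x = σ y := by rw [sq, MulAut.mul_apply, hy]
  rcases hlist (σ y) hwH with (h1 | h1 | h1 | h1) | (h1 | h1 | h1 | h1)
  · rw [h1, one_mul] at hwz; exact absurd hwz.symm hz1
  · rw [h1, zz] at hwz; exact absurd hwz.symm hz1
  · exact absurd (by rw [hσ2x, h1, mul_one]) (hsq2 1 (Or.inl rfl))
  · exact absurd (by rw [hσ2x, h1]) (hsq2 z (Or.inr rfl))
  · rw [h1] at hwy; exact absurd (left_eq_mul.mp hwy) hz1
  · rw [h1] at hwy
    simp only [R, mul_assoc, one_mul] at hwy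
    exact absurd hwy.symm hz1
  · refine ⟨x, y, x * y, hx, hyH, H.mul_mem hx hyH,
      ⟨hz1, zz, hxz, hyz, rfl, hyx, hy.symm, h1, ?_⟩, fun w hw => ?_⟩
    · rw [map_mul, ← hy, h1]
      simp only [R, mul_one]
    · rcases hlist w hw with (h1 | h1 | h1 | h1) | (h1 | h1 | h1 | h1)
      · exact ⟨1, by simp, by simp [h1]⟩
      · exact ⟨1, by simp, by simp [h1]⟩
      · exact ⟨x, by simp, by simp [h1]⟩
      · exact ⟨x, by simp, by simp [h1]⟩
      · exact ⟨y, by simp, by simp [h1]⟩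
      · exact ⟨y, by simp, by simp [h1]⟩
      · exact ⟨x * y, by simp, by simp [h1]⟩
      · exact ⟨x * y, by simp, by simp [h1, mul_assoc]⟩
  -- Here `σ y = x * y * z`; changing the signs of `x` and `y` removes the extra `z`.
  · refine ⟨x * z, y * z, x * y, H.mul_mem hx hzH, H.mul_mem hyH hzH, H.mul_mem hx hyH,
      ⟨hz1, zz, ?_, ?_, ?_, ?_, ?_, ?_, ?_⟩, fun w hw => ?_⟩
    · simp only [R, mul_assoc, mul_one]
    · simp only [R, mul_assoc, mul_one]
    · simp only [R, mul_assoc, mul_one]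
    · simp only [R, mul_assoc, mul_one]
    · rw [map_mul, ← hy, hσz]
    · rw [map_mul, h1, hσz]; simp only [R, mul_assoc, mul_one]
    · rw [map_mul, ← hy, h1]; simp only [R, mul_one]
    · rcases hlist w hw with (h1 | h1 | h1 | h1) | (h1 | h1 | h1 | h1)
      · exact ⟨1, by simp, by simp [h1]⟩
      · exact ⟨1, by simp, by simp [h1]⟩
      · exact ⟨x * z, by simp, by simp [h1, mul_assoc, zz]⟩
      · exact ⟨x * z, by simp, by simp [h1]⟩
      · exact ⟨y * z, by simp, by simp [h1, mul_assoc, zz]⟩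
      · exact ⟨y * z, by simp, by simp [h1]⟩
      · exact ⟨x * y, by simp, by simp [h1]⟩
      · exact ⟨x * y, by simp, by simp [h1, mul_assoc]⟩

end QuaternionTriples

/-! ### Groups that normalize the quaternion units -/

section QuaternionNormalizers

variable {M : Type*} [Group M] {σ : MulAut M} {z i j k : M}

-- A transposition times its conjugate by the rotation is a `3`-cycle. So a rotation-stable
-- permutation group on three points with order prime to `3` is trivial.
set_option maxRecDepth 10000 in
theorem Equiv.Perm.fin_three_rotate_conj : ∀ u : Equiv.Perm (Fin 3), u = 1 ∨ u ^ 3 = 1 ∨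
    (finRotate 3 * u * (finRotate 3)⁻¹ * u) ^ 3 = 1 ∧
      finRotate 3 * u * (finRotate 3)⁻¹ * u ≠ 1 := by
  decide

namespace QuaternionTriple

theorem not_commute (h : QuaternionTriple σ z i j k) : i * j ≠ j * i := by
  intro h1
  rw [h.j_mul_i, h.i_mul_j, left_eq_mul] at h1
  exact h.z_ne h1

theorem k_sq (h : QuaternionTriple σ z i j k) : k * k = z := by
  rw [← h.map_j, ← map_mul, h.j_sq, h.map_z]

theorem z_mul_k (h : QuaternionTriple σ z i j k) : z * k = k * z := by
  rw [← h.k_sq, mul_assoc]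

/-- The cyclic symmetry of a quaternion triple. -/
theorem rotate (h : QuaternionTriple σ z i j k) : QuaternionTriple σ z j k i where
  z_ne := h.z_ne
  z_sq := h.z_sq
  i_sq := h.j_sq
  j_sq := h.k_sq
  i_mul_j := by rw [← h.map_i, ← h.map_j, ← map_mul, h.i_mul_j, h.map_k]
  j_mul_i := by
    rw [← h.map_i, ← h.map_j, ← map_mul, h.j_mul_i, map_mul, h.map_k, h.map_z]
  map_i := h.map_j
  map_j := h.map_k
  map_k := h.map_i

theorem i_ne_j (h : QuaternionTriple σ z i j k) : i ≠ j := by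
  rintro rfl
  exact h.not_commute rfl

theorem i_ne_k (h : QuaternionTriple σ z i j k) : i ≠ k := h.rotate.rotate.i_ne_j.symm

theorem i_ne_one (h : QuaternionTriple σ z i j k) : i ≠ 1 := by
  rintro rfl
  exact h.not_commute (by simp)

theorem inv_i (h : QuaternionTriple σ z i j k) : i⁻¹ = i * z := by
  rw [inv_eq_iff_mul_eq_one, ← mul_assoc, h.i_sq, h.z_sq]

theorem eq_three_of_prime (h : QuaternionTriple σ z i j k) {p : ℕ} (hp : p.Prime)
    (hσ : σ ^ p = 1) : p = 3 := by
  have h3 : ∀ m : ℕ, (σ ^ (3 * m)) i = i := by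
    intro m
    induction m with
    | zero => simp
    | succ m ih => rw [mul_add, pow_add, MulAut.mul_apply, mul_one, h.pow_three_eq_one_on, ih]
  have hpi : (σ ^ p) i = i := by rw [hσ, MulAut.one_apply]
  have hr : p % 3 = 0 ∨ p % 3 = 1 ∨ p % 3 = 2 := by omega
  rw [← Nat.mod_add_div p 3, pow_add, MulAut.mul_apply, h3] at hpi
  rcases hr with hr | hr | hr
  · exact ((Nat.prime_dvd_prime_iff_eq Nat.prime_three hp).mp (Nat.dvd_of_mod_eq_zero hr)).symm
  · rw [hr, pow_one, h.map_i] at hpi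
    exact absurd hpi.symm h.i_ne_j
  · rw [hr, sq, MulAut.mul_apply, h.map_i, h.map_j] at hpi
    exact absurd hpi.symm h.i_ne_k

theorem isQuaternionUnit_cases (h : QuaternionTriple σ z i j k) {x : M}
    (hx : IsQuaternionUnit z i j k x) :
    (x = 1 ∨ x = z) ∨ (x = i ∨ x = i * z) ∨ (x = j ∨ x = j * z) ∨ (x = k ∨ x = k * z) := by
  obtain ⟨a, rfl | rfl | rfl | rfl, rfl | rfl⟩ := hx <;> simp

/-- Quaternion units that commute with `i` and `j` are central. -/
theorem eq_one_or_eq_z (h : QuaternionTriple σ z i j k) {x : M}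
    (hx : IsQuaternionUnit z i j k x) (hi : Commute x i) (hj : Commute x j) : x = 1 ∨ x = z := by
  have hnc : ∀ {i j k : M}, QuaternionTriple σ z i j k → Commute (i * z) j → False := by
    intro i j k h hc
    apply h.not_commute
    have := hc.eq
    rw [mul_assoc, h.z_mul_j, ← mul_assoc, ← mul_assoc] at this
    exact mul_right_cancel this
  rcases h.isQuaternionUnit_cases hx with h1 | (rfl | rfl) | (rfl | rfl) | (rfl | rfl)
  · exact h1
  · exact absurd hj.eq h.not_commute
  · exact (hnc h hj).elim
  · exact absurd hi.eq.symm h.not_commute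
  · exact absurd hi.eq.symm fun h1 => h.not_commute (by
      rw [← mul_assoc, mul_assoc j, h.z_mul_i, ← mul_assoc] at h1
      exact mul_right_cancel h1)
  · exact absurd hi.eq h.rotate.rotate.not_commute
  · exact (hnc h.rotate.rotate hi).elim

theorem exists_of_sq (h : QuaternionTriple σ z i j k) {x : M}
    (hx : IsQuaternionUnit z i j k x) (hxz : x * x = z) :
    ∃ b : Fin 3, x = ![i, j, k] b ∨ x = ![i, j, k] b * z := by
  rcases h.isQuaternionUnit_cases hx with (rfl | rfl) | h1 | h1 | h1
  · rw [one_mul] at hxz; exact absurd hxz.symm h.z_ne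
  · rw [h.z_sq] at hxz; exact absurd hxz.symm h.z_ne
  · exact ⟨0, h1⟩
  · exact ⟨1, h1⟩
  · exact ⟨2, h1⟩

theorem commute_iff (h : QuaternionTriple σ z i j k) (a b : Fin 3) :
    Commute (![i, j, k] a) (![i, j, k] b) ↔ a = b := by
  have h1 := h.not_commute
  have h2 := h.rotate.not_commute
  have h3 := h.rotate.rotate.not_commute
  fin_cases a <;> fin_cases b <;> simp [commute_iff_eq, h1, h2, h3, h1.symm, h2.symm, h3.symm]

theorem z_mul_vec (h : QuaternionTriple σ z i j k) (a : Fin 3) :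
    z * ![i, j, k] a = ![i, j, k] a * z := by
  fin_cases a
  exacts [h.z_mul_i, h.z_mul_j, h.z_mul_k]

theorem vec_sq (h : QuaternionTriple σ z i j k) (a : Fin 3) :
    ![i, j, k] a * ![i, j, k] a = z := by
  fin_cases a
  exacts [h.i_sq, h.j_sq, h.k_sq]

theorem map_vec (h : QuaternionTriple σ z i j k) (a : Fin 3) :
    σ (![i, j, k] a) = ![i, j, k] (finRotate 3 a) := by
  fin_cases a
  exacts [h.map_i, h.map_j, h.map_k]

/-- The axis of `x` is recognized by which of `i, j, k` commutes with `x`; the sign `z` is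
irrelevant to this. -/
theorem vec_unique (h : QuaternionTriple σ z i j k) {x : M} {a b : Fin 3}
    (ha : x = ![i, j, k] a ∨ x = ![i, j, k] a * z)
    (hb : x = ![i, j, k] b ∨ x = ![i, j, k] b * z) : a = b := by
  have hz : ∀ a, Commute z (![i, j, k] a) := h.z_mul_vec
  have key : ∀ {a}, (x = ![i, j, k] a ∨ x = ![i, j, k] a * z) → ∀ b,
      (Commute x (![i, j, k] b) ↔ a = b) := by
    rintro a (rfl | rfl) b
    · exact h.commute_iff a b
    · rw [← h.commute_iff a b]
      refine ⟨fun hc => ?_, fun hc => hc.mul_left (hz b)⟩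
      have := hc.mul_left (hz b)
      rwa [mul_assoc, h.z_sq, mul_one] at this
  have h1 := (key hb b).mpr rfl
  exact (key ha b).mp h1

/-- A `σ`-invariant group of order prime to `3` that normalizes the quaternion units acts on them
by inner automorphisms. -/
theorem exists_eq_mul_of_conj_mem (h : QuaternionTriple σ z i j k) {H L : Subgroup M} [Finite L]
    (hi : i ∈ H) (hj : j ∈ H) (hk : k ∈ H) (hH : ∀ x ∈ H, IsQuaternionUnit z i j k x)
    (hL : ∀ t ∈ L, σ t ∈ L) (h3 : ¬ 3 ∣ Nat.card L)
    (hconj : ∀ t ∈ L, t * i * t⁻¹ ∈ H ∧ t * j * t⁻¹ ∈ H ∧ t * k * t⁻¹ ∈ H) {t : M} (ht : t ∈ L) :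
    ∃ a c, IsQuaternionUnit z i j k a ∧ a ∈ H ∧ t = a * c ∧ Commute c i ∧ Commute c j := by
  have hconj' : ∀ t ∈ L, ∀ a, t * ![i, j, k] a * t⁻¹ ∈ H := by
    intro t ht a
    fin_cases a
    exacts [(hconj t ht).1, (hconj t ht).2.1, (hconj t ht).2.2]
  have hz : ∀ t ∈ L, t * z * t⁻¹ = z := by
    intro t ht
    have h1 := (hconj t ht).1
    have h2 : t * z * t⁻¹ = (t * i * t⁻¹) * (t * i * t⁻¹) := by rw [← h.i_sq]; group
    rcases h.isQuaternionUnit_cases (hH _ h1) with (h4 | h4) | h4 | h4 | h4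
    · exact absurd (conj_eq_one_iff.mp h4) h.i_ne_one
    · rw [h4, h.z_sq] at h2
      exact absurd (conj_eq_one_iff.mp h2) h.z_ne
    all_goals
      rcases h4 with h4 | h4 <;> rw [h2, h4]
    exacts [h.i_sq, by simp only [h.rules, mul_assoc, mul_one], h.j_sq,
      by simp only [h.rules, mul_assoc, mul_one], h.k_sq,
      by simp only [h.rotate.rotate.rules, mul_assoc, mul_one]]
  -- Conjugation by `t` permutes the three axes `±i, ±j, ±k`. The image of `L` in the permutation
  -- group is stable under rotation, via `σ`, and has order prime to `3`, so it is trivial.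
  have hex : ∀ (t : L) (a : Fin 3), ∃ b : Fin 3,
      (t : M) * ![i, j, k] a * (t : M)⁻¹ = ![i, j, k] b ∨
      (t : M) * ![i, j, k] a * (t : M)⁻¹ = ![i, j, k] b * z := by
    intro t a
    refine h.exists_of_sq (hH _ (hconj' t t.2 a)) ?_
    rw [← hz t t.2, ← h.vec_sq a]
    group
  choose f hf using hex
  have hone : f 1 = id := by
    funext a
    exact h.vec_unique (hf 1 a) (Or.inl (by simp))
  have hmul : ∀ s t, f (s * t) = f s ∘ f t := by
    intro s t
    funext a
    refine h.vec_unique (hf (s * t) a) ?_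
    have e1 : ((s * t : L) : M) * ![i, j, k] a * ((s * t : L) : M)⁻¹ =
        s * (t * ![i, j, k] a * (t : M)⁻¹) * (s : M)⁻¹ := by
      push_cast; group
    have e2 : ∀ x, (s : M) * (x * z) * (s : M)⁻¹ = s * x * (s : M)⁻¹ * z := by
      intro x
      conv_rhs => rw [← hz s s.2]
      group
    rw [e1]
    rcases hf t a with h1 | h1 <;> rcases hf s (f t a) with h2 | h2 <;>
      simp [h1, e2, h2, mul_assoc, h.z_sq]
  let π : L →* Equiv.Perm (Fin 3) :=
    MonoidHom.toHomPerm ({ toFun := f, map_one' := hone, map_mul' := hmul } :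
      L →* Function.End (Fin 3))
  have hπ : ∀ t a, π t a = f t a := fun t a => rfl
  have hrot : ∀ t : L, π ⟨σ t, hL t t.2⟩ = finRotate 3 * π t * (finRotate 3)⁻¹ := by
    intro t
    rw [eq_mul_inv_iff_mul_eq]
    ext1 a
    simp only [Equiv.Perm.mul_apply, hπ]
    refine h.vec_unique (hf ⟨σ t, hL t t.2⟩ (finRotate 3 a)) ?_
    rw [← h.map_vec, ← h.map_vec]
    simp only [← map_mul, ← map_inv]
    rcases hf t a with h1 | h1 <;> rw [h1]
    · exact Or.inl rfl
    · exact Or.inr (by rw [map_mul, h.map_z])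
  have hcube : ∀ s : L, π s ^ 3 = 1 → π s = 1 := by
    intro s hs
    have h1 : π s ^ Nat.card L = 1 := by rw [← map_pow, pow_card_eq_one', map_one]
    have h2 := pow_gcd_eq_one.mpr ⟨hs, h1⟩
    rwa [(Nat.Prime.coprime_iff_not_dvd Nat.prime_three).mpr h3, pow_one] at h2
  have htriv : ∀ t : L, π t = 1 := by
    intro t
    rcases Equiv.Perm.fin_three_rotate_conj (π t) with h1 | h1 | ⟨h1, h2⟩
    · exact h1
    · exact hcube t h1
    · rw [← hrot, ← map_mul] at h1 h2
      exact absurd (hcube _ h1) h2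
  have hfix : ∀ a : Fin 3, t * ![i, j, k] a * t⁻¹ = ![i, j, k] a ∨
      t * ![i, j, k] a * t⁻¹ = ![i, j, k] a * z := by
    intro a
    have h1 := hf ⟨t, ht⟩ a
    rw [← hπ, htriv] at h1
    exact h1
  have hzt : z * t = t * z := by
    have := hz t ht
    rw [mul_inv_eq_iff_eq_mul] at this
    exact this.symm
  have hti : t * i = i * t ∨ t * i = i * (z * t) := by
    rcases hfix 0 with h1 | h1 <;> rw [mul_inv_eq_iff_eq_mul] at h1
    · exact Or.inl h1
    · exact Or.inr (h1.trans (mul_assoc i z t))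
  have htj : t * j = j * t ∨ t * j = j * (z * t) := by
    rcases hfix 1 with h1 | h1 <;> rw [mul_inv_eq_iff_eq_mul] at h1
    · exact Or.inl h1
    · exact Or.inr (h1.trans (mul_assoc j z t))
  have hu : ∀ a, a = 1 ∨ a = i ∨ a = j ∨ a = k → IsQuaternionUnit z i j k a :=
    fun a ha => ⟨a, ha, Or.inl rfl⟩
  have hkij := h.i_mul_j.symm
  -- Only signs can change, and the four sign patterns are those of conjugation by `1, i, j, k`.
  -- Dividing `t` by the matching unit leaves an element that commutes with `i` and `j`.
  rcases hti with h1 | h1 <;> rcases htj with h2 | h2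
  · exact ⟨1, t, hu 1 (by simp), H.one_mem, by simp, h1, h2⟩
  · refine ⟨i, i * (z * t), hu i (by simp), hi, ?_, ?_, ?_⟩ <;>
      simp only [commute_iff_eq, h.rules, h1, h2, mul_assoc]
  · refine ⟨j, j * (z * t), hu j (by simp), hj, ?_, ?_, ?_⟩ <;>
      simp only [commute_iff_eq, h.rules, h1, h2, mul_assoc]
  · refine ⟨k, k * (z * t), hu k (by simp), hk, ?_, ?_, ?_⟩ <;>
      simp only [commute_iff_eq, h.rules, h1, h2, hkij, mul_assoc]

end QuaternionTriple

theorem MulAut.symm_apply_mem_of_forall {σ : MulAut M} {H : Subgroup M} [Finite H]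
    (hH : ∀ x ∈ H, σ x ∈ H) {x : M} (hx : x ∈ H) : σ.symm x ∈ H := by
  have hinj : Function.Injective fun y : H => (⟨σ y, hH y y.2⟩ : H) := fun a b hab =>
    Subtype.ext (σ.injective (congrArg Subtype.val hab))
  obtain ⟨y, hy⟩ := Finite.surjective_of_injective hinj ⟨x, hx⟩
  have h1 : σ y = x := congrArg Subtype.val hy
  rw [← h1, MulEquiv.symm_apply_apply]
  exact y.2

/-- A `σ`-invariant `2`-group with a unique involution that contains a group of quaternion units
is equal to it. -/
theorem QuaternionTriple.eq_of_le (h : QuaternionTriple σ z i j k) {H Q : Subgroup M} [Finite Q]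
    (hi : i ∈ H) (hj : j ∈ H) (hk : k ∈ H) (hH : ∀ x ∈ H, IsQuaternionUnit z i j k x)
    (hHinv : ∀ x ∈ H, σ x ∈ H) (hHQ : H ≤ Q) (hQ : IsPGroup 2 Q) (hQinv : ∀ x ∈ Q, σ x ∈ Q)
    (huniq : ∀ x ∈ Q, x * x = 1 → x = 1 ∨ x = z) : H = Q := by
  have : Finite H := Finite.Set.subset (Q : Set M) hHQ
  have := Fact.mk Nat.prime_two
  by_contra hne
  have hlt : H.subgroupOf Q < ⊤ := by
    rw [lt_top_iff_ne_top, Ne, Subgroup.subgroupOf_eq_top]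
    exact fun h1 => hne (le_antisymm hHQ h1)
  have : Group.IsNilpotent Q := hQ.isNilpotent
  obtain ⟨t, ht, htH⟩ := SetLike.exists_of_lt (Group.normalizerCondition_of_isNilpotent _ hlt)
  let L : Subgroup M := Q ⊓ Subgroup.normalizer H
  have hLfin : Finite L := Finite.Set.subset (Q : Set M) (fun x hx => hx.1)
  have hLQ : IsPGroup 2 L := hQ.to_le inf_le_left
  have h3 : ¬ 3 ∣ Nat.card L := by
    obtain ⟨m, hm⟩ := IsPGroup.iff_card.mp hLQ
    rw [hm]
    intro hd
    exact absurd (Nat.prime_three.dvd_of_dvd_pow hd) (by norm_num)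
  have hsym : ∀ x, σ x ∈ H ↔ x ∈ H := fun x =>
    ⟨fun hx => by simpa using MulAut.symm_apply_mem_of_forall hHinv hx, hHinv x⟩
  have hLinv : ∀ t ∈ L, σ t ∈ L := by
    intro t ht
    refine ⟨hQinv t ht.1, ?_⟩
    change σ t ∈ Subgroup.normalizer _
    rw [Subgroup.mem_normalizer_iff]
    intro x
    have h1 := (Subgroup.mem_normalizer_iff.mp ht.2) (σ.symm x)
    rw [← hsym, ← hsym (t * _ * _)] at h1
    simpa using h1
  have htL : (t : M) ∈ L := by
    refine ⟨t.2, ?_⟩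
    change (t : M) ∈ Subgroup.normalizer _
    rw [Subgroup.mem_normalizer_iff] at ht ⊢
    intro x
    constructor
    · intro hx
      exact (ht ⟨x, hHQ hx⟩).mp hx
    · intro hx
      have hxQ : x ∈ Q := by
        have := Q.mul_mem (Q.mul_mem (Q.inv_mem t.2) (hHQ hx)) t.2
        simpa [mul_assoc] using this
      exact (ht ⟨x, hxQ⟩).mpr hx
  have hconj : ∀ t ∈ L, ∀ x ∈ H, t * x * t⁻¹ ∈ H := fun t ht x hx =>
    (Subgroup.mem_normalizer_iff.mp ht.2 x).mp hx
  obtain ⟨a, c, -, haH, htac, hci, hcj⟩ := h.exists_eq_mul_of_conj_mem hi hj hk hH hLinv h3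
    (fun t ht => ⟨hconj t ht i hi, hconj t ht j hj, hconj t ht k hk⟩) htL
  have hcQ : c ∈ Q := by
    have := Q.mul_mem (Q.inv_mem (hHQ haH)) t.2
    rwa [htac, inv_mul_cancel_left] at this
  have hzH : z ∈ H := by rw [← h.i_sq]; exact H.mul_mem hi hi
  -- If `c` centralizes `i` and `c ^ 2 = z`, then `(c * i) ^ 2 = 1`, so uniqueness of the involution
  -- puts `c * i`, and with it `c`, in `H`.
  have key : ∀ m : ℕ, ∀ c ∈ Q, Commute c i → Commute c j → c ^ 2 ^ m = 1 → c = 1 ∨ c = z := by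
    intro m
    induction m with
    | zero => intro c _ _ _ h1; exact Or.inl (by simpa using h1)
    | succ m ih =>
      intro c hc hci hcj h1
      rcases ih (c ^ 2) (Q.pow_mem hc 2) (hci.pow_left 2) (hcj.pow_left 2)
        (by rw [← pow_mul, ← pow_succ', h1]) with h2 | h2
      · exact huniq c hc (by rw [← sq, h2])
      · have h4 : c * i * (c * i) = 1 := by
          rw [← sq, hci.mul_pow, h2, sq, h.i_sq, h.z_sq]
        have h5 : c * i ∈ H := by
          rcases huniq _ (Q.mul_mem hc (hHQ hi)) h4 with h5 | h5 <;> rw [h5]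
          exacts [H.one_mem, hzH]
        have h6 : c ∈ H := by simpa using H.mul_mem h5 (H.inv_mem hi)
        exact h.eq_one_or_eq_z (hH c h6) hci hcj
  obtain ⟨m, hm⟩ := hQ ⟨c, hcQ⟩
  apply htH
  rw [Subgroup.mem_subgroupOf, htac]
  refine H.mul_mem haH ?_
  rcases key m c hcQ hci hcj (by simpa using congrArg Subtype.val hm) with h1 | h1 <;> rw [h1]
  exacts [H.one_mem, hzH]

end QuaternionNormalizers

/-! ### Coprime automorphisms of semiprime-cyclic groups -/

section SemiprimeCyclic

open scoped Pointwise

variable {M : Type*} [Group M]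

theorem IsSemiprimeCyclic.subgroup (h : IsSemiprimeCyclic M) (N : Subgroup M) :
    IsSemiprimeCyclic N := by
  rintro H ⟨p, q, hp, hq, hH⟩
  have := h (H.map N.subtype) ⟨p, q, hp, hq, by
    rw [← hH]; exact Subgroup.card_map_of_injective N.subtype_injective⟩
  exact (H.equivMapOfInjective N.subtype N.subtype_injective).isCyclic.mpr this

/-- Commuting elements of the same prime order of a semiprime-cyclic group generate the same
subgroup. -/
theorem IsSemiprimeCyclic.mem_zpowers (h : IsSemiprimeCyclic M) {q : ℕ} (hq : q.Prime) {z x : M}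
    (hz : orderOf z = q) (hx : orderOf x = q) (hzx : Commute z x) : x ∈ Subgroup.zpowers z := by
  by_contra hxz
  have hcomm : ∀ (a : Subgroup.zpowers z) (b : Subgroup.zpowers x),
      Commute ((Subgroup.zpowers z).subtype a) ((Subgroup.zpowers x).subtype b) := by
    rintro ⟨_, m, rfl⟩ ⟨_, n, rfl⟩
    exact (hzx.zpow_left m).zpow_right n
  let f := MonoidHom.noncommCoprod (Subgroup.zpowers z).subtype (Subgroup.zpowers x).subtype hcomm
  have hf : Function.Injective f := by
    rw [MonoidHom.noncommCoprod_injective]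
    refine ⟨Subtype.val_injective, Subtype.val_injective, ?_⟩
    rw [Subgroup.range_subtype, Subgroup.range_subtype, disjoint_iff]
    have := Fact.mk hq
    by_contra hne
    obtain ⟨y, hy, hy1⟩ := (Subgroup.zpowers z ⊓ Subgroup.zpowers x).bot_or_exists_ne_one.resolve_left hne
    have hyx : Subgroup.zpowers y ≤ Subgroup.zpowers x := by simpa using hy.2
    have hyz : Subgroup.zpowers y ≤ Subgroup.zpowers z := by simpa using hy.1
    have hfin : Finite (Subgroup.zpowers x) :=
      finite_zpowers.mpr (orderOf_pos_iff.mp (hx ▸ hq.pos))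
    have hc : Nat.card (Subgroup.zpowers y) = q := by
      have h1 := Subgroup.card_dvd_of_le hyx
      rw [Nat.card_zpowers, Nat.card_zpowers, hx] at h1
      rw [Nat.card_zpowers]
      exact ((Nat.dvd_prime hq).mp h1).resolve_left fun h2 => hy1 (orderOf_eq_one_iff.mp h2)
    have h1 := Subgroup.eq_of_le_of_card_ge hyx (by rw [hc, Nat.card_zpowers, hx])
    exact hxz (hyz (h1 ▸ Subgroup.mem_zpowers x))
  have hcard : Nat.card f.range = q * q := by
    rw [← Nat.card_congr (MonoidHom.ofInjective hf).toEquiv, Nat.card_prod, Nat.card_zpowers,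
      Nat.card_zpowers, hz, hx]
  -- The range is a product of two groups of order `q`: it has order `q * q` but exponent dividing
  -- `q`, so it cannot be cyclic.
  have hcyc := h f.range ⟨q, q, hq, hq, hcard⟩
  have h1 : Monoid.exponent f.range ∣ q := by
    refine Monoid.exponent_dvd_of_forall_pow_eq_one ?_
    rintro ⟨_, ⟨a, b⟩, rfl⟩
    ext
    rw [Subgroup.coe_pow]
    simp only [← map_pow, Prod.pow_mk, Subgroup.coe_one]
    rw [← map_one f]
    congr 1
    ext1
    · rw [Prod.fst_one, ← orderOf_dvd_iff_pow_eq_one, ← hz, ← Nat.card_zpowers z]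
      exact orderOf_dvd_natCard a
    · rw [Prod.snd_one, ← orderOf_dvd_iff_pow_eq_one, ← hx, ← Nat.card_zpowers x]
      exact orderOf_dvd_natCard b
  rw [IsCyclic.exponent_eq_card, hcard] at h1
  have := Nat.le_of_dvd hq.pos h1
  have := hq.one_lt
  nlinarith

/-- A nontrivial `q`-subgroup of a semiprime-cyclic group has a unique subgroup of order `q`. -/
theorem IsSemiprimeCyclic.exists_unique_order (h : IsSemiprimeCyclic M) {q : ℕ} (hq : q.Prime)
    {Q : Subgroup M} [Finite Q] (hQ : IsPGroup q Q) (hne : Q ≠ ⊥) :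
    ∃ z ∈ Q, orderOf z = q ∧ ∀ x ∈ Q, x ^ q = 1 → x ∈ Subgroup.zpowers z := by
  have := Fact.mk hq
  have := (Subgroup.nontrivial_iff_ne_bot Q).mpr hne
  have hc := hQ.center_nontrivial
  have hdvd : q ∣ Nat.card (Subgroup.center Q) := by
    obtain ⟨n, hn⟩ := IsPGroup.iff_card.mp (hQ.to_subgroup (Subgroup.center Q))
    rw [hn]
    refine dvd_pow_self q ?_
    rintro rfl
    have := Finite.one_lt_card (α := Subgroup.center Q)
    rw [hn] at this
    simp at this
  obtain ⟨z, hz⟩ := exists_prime_orderOf_dvd_card' q hdvd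
  have hz' : orderOf ((z : Q) : M) = q := by rw [Subgroup.orderOf_coe, Subgroup.orderOf_coe, hz]
  refine ⟨(z : Q), (z : Q).2, hz', fun x hx hxq => ?_⟩
  by_cases hx1 : x = 1
  · rw [hx1]; exact Subgroup.one_mem _
  refine h.mem_zpowers hq hz' (orderOf_eq_prime hxq hx1) ?_
  have := Subgroup.mem_center_iff.mp z.2 ⟨x, hx⟩
  exact (congrArg Subtype.val this).symm

/-- If `g` of prime order `p` normalizes a subgroup generated by `x` of prime order `q ≠ p` in a
semiprime-cyclic group, then `g` and `x` commute. -/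
theorem IsSemiprimeCyclic.commute_of_conj_mem (h : IsSemiprimeCyclic M) {p q : ℕ} (hp : p.Prime)
    (hq : q.Prime) (hpq : p ≠ q) {g x : M} (hg : orderOf g = p) (hx : orderOf x = q)
    (hgx : g * x * g⁻¹ ∈ Subgroup.zpowers x) : Commute g x := by
  let K : Subgroup M := Subgroup.zpowers x ⊔ Subgroup.zpowers g
  have hfx : Finite (Subgroup.zpowers x) :=
    finite_zpowers.mpr (orderOf_pos_iff.mp (hx ▸ hq.pos))
  have hfg : Finite (Subgroup.zpowers g) :=
    finite_zpowers.mpr (orderOf_pos_iff.mp (hg ▸ hp.pos))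
  have hnorm : Subgroup.zpowers g ≤ Subgroup.normalizer (Subgroup.zpowers x) := by
    rw [Subgroup.zpowers_le]
    have hle : (Subgroup.zpowers x).map (MulAut.conj g).toMonoidHom ≤ Subgroup.zpowers x := by
      rw [MonoidHom.map_zpowers, Subgroup.zpowers_le]
      exact hgx
    have heq := Subgroup.eq_of_le_of_card_ge hle
      (Subgroup.card_map_of_injective (MulAut.conj g).injective).ge
    rw [Subgroup.mem_normalizer_iff]
    intro y
    refine ⟨fun hy => hle ⟨y, hy, rfl⟩, fun hy => ?_⟩
    rw [← heq] at hy
    obtain ⟨w, hw, hwy⟩ := hy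
    rwa [← (MulAut.conj g).injective hwy]
  have hmul : (Subgroup.zpowers x : Set M) * (Subgroup.zpowers g : Set M) = K :=
    (Subgroup.coe_mul_of_right_le_normalizer_left _ _ hnorm).symm
  have hcard : Nat.card K = q * p := by
    have hfK : Finite K := by
      have : ((K : Subgroup M) : Set M).Finite := by
        rw [← hmul]
        exact Set.Finite.mul (Set.toFinite _) (Set.toFinite _)
      exact this
    refine le_antisymm ?_ (Nat.le_of_dvd Nat.card_pos ?_)
    · have h1 := Set.natCard_mul_le (s := (Subgroup.zpowers x : Set M))
        (t := (Subgroup.zpowers g : Set M))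
      rw [hmul] at h1
      refine h1.trans_eq ?_
      rw [← hx, ← hg, ← Nat.card_zpowers, ← Nat.card_zpowers]
      rfl
    · refine Nat.Coprime.mul_dvd_of_dvd_of_dvd ((Nat.coprime_primes hq hp).mpr hpq.symm) ?_ ?_
      · rw [← hx, ← Nat.card_zpowers]
        exact Subgroup.card_dvd_of_le le_sup_left
      · rw [← hg, ← Nat.card_zpowers]
        exact Subgroup.card_dvd_of_le le_sup_right
  have hcyc := h K ⟨q, p, hq, hp, hcard⟩
  have hgK : g ∈ K := (le_sup_right : _ ≤ K) (Subgroup.mem_zpowers g)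
  have hxK : x ∈ K := (le_sup_left : _ ≤ K) (Subgroup.mem_zpowers x)
  exact congrArg Subtype.val (IsCyclic.commGroup.mul_comm (⟨g, hgK⟩ : K) ⟨x, hxK⟩)

/-- A prime-order automorphism of a finite group of order prime to its order stabilizes a Sylow
subgroup for each prime. -/
theorem MulAut.exists_sylow_apply_mem [Finite M] {σ : MulAut M} {p : ℕ} (hp : p.Prime)
    (hσ : σ ^ p = 1) (hpM : ¬ p ∣ Nat.card M) (q : ℕ) [Fact q.Prime] :
    ∃ Q : Sylow q M, ∀ x ∈ Q, σ x ∈ Q := by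
  have := Fact.mk hp
  have hpg : IsPGroup p (Subgroup.zpowers σ) := by
    rintro ⟨_, n, rfl⟩
    refine ⟨1, ?_⟩
    ext1
    simp only [pow_one, SubgroupClass.coe_pow, Subgroup.coe_one]
    rw [← zpow_natCast, ← zpow_mul, mul_comm, zpow_mul, zpow_natCast, hσ, one_zpow]
  -- The number of Sylow subgroups divides the order of `M`, so it is prime to `p` and the `p`-group
  -- `⟨σ⟩` has a fixed point among them.
  have hnd : ¬ p ∣ Nat.card (Sylow q M) := fun hd => hpM
    ((hd.trans (default : Sylow q M).card_dvd_index).trans (Subgroup.index_dvd_card _))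
  obtain ⟨Q, hQ⟩ := hpg.nonempty_fixed_point_of_prime_not_dvd_card (Sylow q M) hnd
  refine ⟨Q, fun x hx => ?_⟩
  have h1 : σ • Q = Q := hQ ⟨σ, Subgroup.mem_zpowers σ⟩
  have h2 : σ x ∈ ((σ • Q : Sylow q M) : Subgroup M) :=
    Subgroup.smul_mem_pointwise_smul x σ _ hx
  rwa [h1] at h2

variable {σ : MulAut M} {z i j k : M}

/-- A coprime automorphism of prime order of a semiprime-cyclic group that acts trivially on the
subgroups of prime order that it stabilizes either fixes a stable `q`-subgroup pointwise, or
`q = 2` and the subgroup is a quaternion group that is permuted as in a `QuaternionTriple`. -/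
theorem IsSemiprimeCyclic.fixed_or_quaternion [Finite M] (h : IsSemiprimeCyclic M) {p q : ℕ}
    (hp : p.Prime) (hσ : σ ^ p = 1)
    (hfix : ∀ x, (orderOf x).Prime → σ x ∈ Subgroup.zpowers x → σ x = x) (hq : q.Prime)
    (hqp : q ≠ p) {Q : Subgroup M} (hQ : IsPGroup q Q) (hinv : ∀ x ∈ Q, σ x ∈ Q) :
    (∀ x ∈ Q, σ x = x) ∨ q = 2 ∧ ∃ z i j k, QuaternionTriple σ z i j k ∧ i ∈ Q ∧ j ∈ Q ∧ k ∈ Q ∧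
      ∀ x ∈ Q, IsQuaternionUnit z i j k x := by
  by_contra! hcon
  obtain ⟨⟨x₀, hx₀, hmoved⟩, hcon⟩ := hcon
  have hne : Q ≠ ⊥ := by
    rintro rfl
    rw [Subgroup.mem_bot] at hx₀
    simp [hx₀] at hmoved
  obtain ⟨z, hzQ, hz, huniq⟩ := h.exists_unique_order hq hQ hne
  obtain ⟨H, hHQ, hH⟩ := MulAut.exists_isMinimalMoved hinv ⟨x₀, hx₀, hmoved⟩
  have hHp : IsPGroup q H := hQ.to_le hHQ
  have hco : q.Coprime p := (Nat.coprime_primes hq hp).mpr hqp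
  have hfixQ : ∀ x ∈ Q, x ^ q = 1 → σ x = x := by
    intro x hx hxq
    by_cases hx1 : x = 1
    · rw [hx1, map_one]
    have := Fact.mk hq
    have hxo := orderOf_eq_prime hxq hx1
    refine hfix x (hxo ▸ hq) ?_
    have h1 := huniq x hx hxq
    have h2 := huniq (σ x) (hinv x hx) (by rw [← map_pow, hxq, map_one])
    have h3 : Subgroup.zpowers x = Subgroup.zpowers z :=
      Subgroup.eq_of_le_of_card_ge (by simpa using h1) (by
        rw [Nat.card_zpowers, Nat.card_zpowers, hz, hxo])
    rwa [h3]
  obtain rfl := hH.eq_two hq hHp hco hσ fun x hx => hfixQ x (hHQ hx)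
  have hz1 : z ≠ 1 := by
    rintro rfl
    simp at hz
  have zz : z * z = 1 := by rw [← sq, ← hz, pow_orderOf_eq_one]
  have huniq' : ∀ x ∈ Q, x * x = 1 → x = 1 ∨ x = z := by
    intro x hx hxx
    obtain ⟨n, rfl⟩ := huniq x hx (by rw [sq, hxx])
    simp only
    rcases Int.even_or_odd' n with ⟨m, rfl | rfl⟩
    · left; rw [zpow_mul, zpow_ofNat, sq, zz, one_zpow]
    · right; rw [zpow_add, zpow_mul, zpow_ofNat, sq, zz, one_zpow, one_mul, zpow_one]
  have hzH : z ∈ H := by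
    have hHne : H ≠ ⊥ := by
      rintro rfl
      obtain ⟨x, hx, hxx⟩ := hH.exists_moved
      rw [Subgroup.mem_bot] at hx
      simp [hx] at hxx
    obtain ⟨y, hyH, hy, -⟩ := h.exists_unique_order hq hHp hHne
    have hy2 : y * y = 1 := by rw [← sq, ← hy, pow_orderOf_eq_one]
    rcases huniq' y (hHQ hyH) hy2 with rfl | rfl
    · simp at hy
    · exact hyH
  obtain ⟨i, j, k, hi, hj, hk, hT, hunit⟩ := hH.exists_quaternionTriple hHp hco hσ hzH hz1 zz
    fun x hx => huniq' x (hHQ hx)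
  obtain rfl := hT.eq_of_le hi hj hk hunit hH.apply_mem hHQ hQ hinv huniq'
  obtain ⟨x, hx, hxu⟩ := hcon rfl z i j k hT hi hj hk
  exact hxu (hunit x hx)

theorem IsQuaternionUnit.card_le {Q : Subgroup M} [Finite Q]
    (hQ : ∀ x ∈ Q, IsQuaternionUnit z i j k x) : Nat.card Q ≤ 8 := by
  classical
  let S : Finset M := {1, 1 * z, i, i * z, j, j * z, k, k * z}
  have hsub : (Q : Set M) ⊆ S := by
    intro x hx
    obtain ⟨a, rfl | rfl | rfl | rfl, rfl | rfl⟩ := hQ x hx <;> simp [S]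
  have h1 := Set.ncard_le_ncard hsub (Finset.finite_toSet S)
  rw [Set.ncard_coe_finset] at h1
  refine h1.trans ?_
  repeat refine (Finset.card_insert_le _ _).trans (Nat.succ_le_succ ?_)
  simp

/-- The fixed subgroup of an automorphism. -/
def MulAut.fixedSubgroup (σ : MulAut M) : Subgroup M where
  carrier := {x | σ x = x}
  one_mem' := map_one σ
  mul_mem' {a b} ha hb := by
    simp only [Set.mem_ofPred_eq] at *
    rw [map_mul, ha, hb]
  inv_mem' {a} ha := by
    simp only [Set.mem_ofPred_eq] at *
    rw [map_inv, ha]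

theorem MulAut.mem_fixedSubgroup {x : M} : x ∈ σ.fixedSubgroup ↔ σ x = x := Iff.rfl

theorem QuaternionTriple.not_fixed (h : QuaternionTriple σ z i j k) :
    σ i ≠ i ∧ σ j ≠ j ∧ σ k ≠ k := by
  rw [h.map_i, h.map_j, h.map_k]
  exact ⟨h.i_ne_j.symm, h.rotate.i_ne_j.symm, h.i_ne_k⟩

/-- The elements `1, i, j, k` lie in distinct left cosets of the fixed subgroup, since their
quotients are moved; with index at most four they represent all cosets. -/
theorem QuaternionTriple.exists_eq_mul_of_index_le [Finite M] (h : QuaternionTriple σ z i j k)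
    (hindex : σ.fixedSubgroup.index ≤ 4) (m : M) :
    ∃ a c, (a = 1 ∨ a = i ∨ a = j ∨ a = k) ∧ m = a * c ∧ σ c = c := by
  let f : Fin 4 → M ⧸ σ.fixedSubgroup := fun a => QuotientGroup.mk (![1, i, j, k] a)
  have hone : ∀ {i j k : M}, QuaternionTriple σ z i j k →
      (QuotientGroup.mk 1 : M ⧸ σ.fixedSubgroup) ≠ QuotientGroup.mk i := by
    intro i j k h h1
    rw [QuotientGroup.eq, MulAut.mem_fixedSubgroup, inv_one, one_mul] at h1
    exact h.not_fixed.1 h1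
  have hij : ∀ {i j k : M}, QuaternionTriple σ z i j k →
      (QuotientGroup.mk i : M ⧸ σ.fixedSubgroup) ≠ QuotientGroup.mk j := by
    intro i j k h h1
    rw [QuotientGroup.eq, MulAut.mem_fixedSubgroup, h.inv_i, mul_assoc, h.z_mul_j, ← mul_assoc,
      h.i_mul_j, map_mul, h.map_z] at h1
    exact h.not_fixed.2.2 (mul_right_cancel h1)
  have h1 := hone h
  have h2 := hone h.rotate
  have h3 := hone h.rotate.rotate
  have h4 := hij h
  have h5 := hij h.rotate
  have h6 := hij h.rotate.rotate
  have hinj : Function.Injective f := by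
    intro a b
    fin_cases a <;> fin_cases b <;>
      simp [f, h1, h2, h3, h4, h5, h6, h1.symm, h2.symm, h3.symm, h4.symm, h5.symm, h6.symm]
  have hsurj : Function.Surjective f := by
    refine (Nat.bijective_iff_injective_and_card f).mpr ⟨hinj, ?_⟩ |>.2
    refine le_antisymm (Nat.card_le_card_of_injective f hinj) ?_
    rw [Nat.card_fin]
    exact hindex
  obtain ⟨a, ha⟩ := hsurj (QuotientGroup.mk m)
  rw [QuotientGroup.eq] at ha
  refine ⟨![1, i, j, k] a, _, ?_, (mul_inv_cancel_left _ m).symm, ha⟩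
  fin_cases a <;> simp

/-- The structure of a semiprime-cyclic group with a coprime automorphism `σ` of prime order that
acts trivially on the subgroups of prime order that it stabilizes. -/
theorem IsSemiprimeCyclic.eq_one_or_quaternion [Finite M] (h : IsSemiprimeCyclic M) {p : ℕ}
    (hp : p.Prime) (hσ : σ ^ p = 1) (hpM : ¬ p ∣ Nat.card M)
    (hfix : ∀ x, (orderOf x).Prime → σ x ∈ Subgroup.zpowers x → σ x = x) :
    σ = 1 ∨ p = 3 ∧ ∃ z i j k, QuaternionTriple σ z i j k ∧
      ∀ m, ∃ a c, (IsQuaternionUnit z i j k a) ∧ m = a * c ∧ Commute c i ∧ Commute c j ∧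
        σ c = c := by
  have hmem : ∀ q, q.Prime → (∃ Q : Sylow q M, (∀ x ∈ Q, σ x ∈ Q) ∧ ∀ x ∈ Q, σ x = x) →
      ∀ n, q ^ n ∣ Nat.card M → q ^ n ∣ Nat.card σ.fixedSubgroup := by
    rintro q hq ⟨Q, -, hQ⟩ n hn
    have := Fact.mk hq
    exact (Q.pow_dvd_card_of_pow_dvd_card hn).trans (Subgroup.card_dvd_of_le hQ)
  by_cases hall : ∀ q, q.Prime → q ∣ Nat.card M →
      ∃ Q : Sylow q M, (∀ x ∈ Q, σ x ∈ Q) ∧ ∀ x ∈ Q, σ x = x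
  · left
    have hd : Nat.card M ∣ Nat.card σ.fixedSubgroup := by
      rw [Nat.dvd_iff_prime_pow_dvd_dvd]
      intro q n hq hn
      rcases Nat.eq_zero_or_pos n with rfl | hn0
      · simp
      · exact hmem q hq (hall q hq ((dvd_pow_self q hn0.ne').trans hn)) n hn
    have htop : σ.fixedSubgroup = ⊤ :=
      Subgroup.eq_top_of_card_eq _ (Nat.dvd_antisymm (Subgroup.card_subgroup_dvd_card _) hd)
    ext x
    exact (htop ▸ Subgroup.mem_top x : x ∈ σ.fixedSubgroup)
  right
  push Not at hall
  obtain ⟨q, hq, hqM, hall⟩ := hall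
  have hne : ∀ q, q ∣ Nat.card M → q ≠ p := fun q hd h1 => hpM (h1 ▸ hd)
  have := Fact.mk hq
  obtain ⟨Q, hQinv⟩ := MulAut.exists_sylow_apply_mem hp hσ hpM q
  obtain ⟨x₀, hx₀, hx₀'⟩ := hall Q hQinv
  obtain ⟨rfl, z, i, j, k, hT, hi, hj, hk, hunit⟩ :=
    (h.fixed_or_quaternion hp hσ hfix hq (hne q hqM) Q.isPGroup' hQinv).resolve_left
      fun h1 => hx₀' (h1 x₀ hx₀)
  obtain rfl := hT.eq_three_of_prime hp hσ
  refine ⟨rfl, z, i, j, k, hT, ?_⟩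
  have hQ8 : Nat.card Q ∣ 8 := by
    obtain ⟨n, hn⟩ := IsPGroup.iff_card.mp Q.isPGroup'
    have h1 := IsQuaternionUnit.card_le hunit
    change Nat.card Q = 2 ^ n at hn
    change Nat.card Q ≤ 8 at h1
    rw [hn] at h1 ⊢
    exact pow_dvd_pow 2 (m := n) (n := 3) ((Nat.pow_le_pow_iff_right (by norm_num)).mp h1)
  -- For odd primes a Sylow subgroup is fixed pointwise. At `2` the Sylow order divides `8`, and the
  -- fixed involution `z` accounts for one factor `2`.
  have hfour : Nat.card M ∣ 4 * Nat.card σ.fixedSubgroup := by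
    rw [Nat.dvd_iff_prime_pow_dvd_dvd]
    intro r n hr hn
    rcases Nat.eq_zero_or_pos n with rfl | hn0
    · simp
    have hrM := (dvd_pow_self r hn0.ne').trans hn
    have := Fact.mk hr
    by_cases hr2 : r = 2
    · subst hr2
      have h1 := (Q.pow_dvd_card_of_pow_dvd_card hn).trans hQ8
      have h2 : 2 ∣ Nat.card σ.fixedSubgroup := by
        rw [← orderOf_eq_prime (p := 2) (by rw [sq, hT.z_sq]) hT.z_ne]
        exact Subgroup.orderOf_dvd_natCard _ hT.map_z
      exact h1.trans (mul_dvd_mul_left 4 h2)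
    · obtain ⟨R, hRinv⟩ := MulAut.exists_sylow_apply_mem hp hσ hpM r
      refine Dvd.dvd.mul_left (hmem r hr ⟨R, hRinv, ?_⟩ n hn) 4
      exact (h.fixed_or_quaternion hp hσ hfix hr (hne r hrM) R.isPGroup' hRinv).resolve_right
        fun h1 => hr2 h1.1
  have hindex : σ.fixedSubgroup.index ≤ 4 := by
    rw [← σ.fixedSubgroup.card_mul_index, mul_comm 4] at hfour
    exact Nat.le_of_dvd (by norm_num) (Nat.dvd_of_mul_dvd_mul_left Nat.card_pos hfour)
  have hbr : ∀ m, m * (σ m)⁻¹ ∈ Q := by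
    intro m
    obtain ⟨a, c, ha, rfl, hc⟩ := hT.exists_eq_mul_of_index_le hindex m
    have haQ : a ∈ Q := by
      rcases ha with rfl | rfl | rfl | rfl
      exacts [Subgroup.one_mem _, hi, hj, hk]
    have h1 : a * c * (σ (a * c))⁻¹ = a * (σ a)⁻¹ := by rw [map_mul, hc]; group
    rw [h1]
    exact Subgroup.mul_mem _ haQ (Subgroup.inv_mem _ (hQinv a haQ))
  -- Comparing `m * (σ m)⁻¹` for `m * j` and for `m` gives `m * (j * k⁻¹) * m⁻¹`, the inverse of the
  -- conjugate of `i`. Thus all conjugates of `i, j, k` stay in `Q`.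
  have hconj : ∀ {i j k : M}, QuaternionTriple σ z i j k → ∀ m, m * i * m⁻¹ ∈ Q := by
    intro i j k hT m
    have h1 := Subgroup.mul_mem _ (hbr (m * j)) (Subgroup.inv_mem _ (hbr m))
    have h2 : m * j * (σ (m * j))⁻¹ * (m * (σ m)⁻¹)⁻¹ = (m * i * m⁻¹)⁻¹ := by
      rw [map_mul, hT.map_j]
      have h3 : j * k⁻¹ = i⁻¹ := by
        rw [mul_inv_eq_iff_eq_mul, ← hT.i_mul_j, inv_mul_cancel_left]
      calc m * j * (σ m * k)⁻¹ * (m * (σ m)⁻¹)⁻¹ = m * (j * k⁻¹) * m⁻¹ := by group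
        _ = (m * i * m⁻¹)⁻¹ := by rw [h3]; group
    rw [h2] at h1
    exact (Subgroup.inv_mem_iff _).mp h1
  intro m
  obtain ⟨a, c, ha, haQ, hmac, hci, hcj⟩ := hT.exists_eq_mul_of_conj_mem (L := ⊤) hi hj hk hunit
    (fun t _ => Subgroup.mem_top _) (by rwa [Subgroup.card_top])
    (fun t _ => ⟨hconj hT t, hconj hT.rotate t, hconj hT.rotate.rotate t⟩) (Subgroup.mem_top m)
  refine ⟨a, c, ha, hmac, hci, hcj, ?_⟩
  have hck : Commute c k := by rw [← hT.i_mul_j]; exact hci.mul_right hcj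
  have hcz : Commute c z := by rw [← hT.i_sq]; exact hci.mul_right hci
  have hσi : Commute (σ c) i := by
    have := hck.map σ
    rwa [hT.map_k] at this
  have hσj : Commute (σ c) j := by
    have := hci.map σ
    rwa [hT.map_i] at this
  -- Both `c` and `σ c` centralize the units, so `c * (σ c)⁻¹` is central in `Q`, hence `1` or `z`;
  -- coprimality excludes translation by `z`.
  rcases hT.eq_one_or_eq_z (hunit _ (hbr c)) (hci.mul_left hσi.inv_left)
    (hcj.mul_left hσj.inv_left) with h1 | h1
  · exact (mul_inv_eq_one.mp h1).symm
  · rw [mul_inv_eq_iff_eq_mul] at h1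
    have h2 : σ c = c * z := by
      rw [hcz.eq]
      nth_rw 2 [h1]
      rw [← mul_assoc, hT.z_sq, one_mul]
    have hz2 := orderOf_eq_prime (p := 2) (by rw [sq, hT.z_sq]) hT.z_ne
    exact absurd (MulAut.eq_one_of_apply_eq_mul hσ h2 hT.map_z (by rw [hz2]; norm_num)) hT.z_ne

end SemiprimeCyclic

/-! ### The induction on the order of the group -/

section MainTheorem

/-- A nontrivial finite solvable group has a normal subgroup of prime index. -/
theorem exists_normal_index_prime (G : Type*) [Group G] [Finite G] [Group.IsSolvable G]
    [Nontrivial G] : ∃ M : Subgroup G, M.Normal ∧ M.index.Prime := by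
  obtain ⟨M, hM, hle⟩ := (eq_top_or_exists_le_coatom (commutator G)).resolve_left
    (Group.IsSolvable.commutator_lt_top_of_nontrivial G).ne
  have hnormal : M.Normal := by
    refine ⟨fun m hm g => ?_⟩
    have h1 : g * m * g⁻¹ * m⁻¹ ∈ M := hle (Subgroup.commutator_mem_commutator (Subgroup.mem_top g)
      (Subgroup.mem_top m))
    have h2 := M.mul_mem h1 hm
    rwa [inv_mul_cancel_right] at h2
  refine ⟨M, hnormal, ?_⟩
  have hne : M.index ≠ 1 := fun h => hM.1 (Subgroup.index_eq_one.mp h)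
  obtain ⟨q, hq, hd⟩ := Nat.exists_prime_and_dvd hne
  have := Fact.mk hq
  obtain ⟨y, hy⟩ := exists_prime_orderOf_dvd_card' (G := G ⧸ M) q hd
  have hlt : M < (Subgroup.zpowers y).comap (QuotientGroup.mk' M) := by
    refine lt_of_le_of_ne ?_ fun h => ?_
    · intro m hm
      rw [Subgroup.mem_comap, QuotientGroup.mk'_apply, (QuotientGroup.eq_one_iff m).mpr hm]
      exact Subgroup.one_mem _
    · obtain ⟨x, rfl⟩ := QuotientGroup.mk_surjective y
      have hx : x ∈ (Subgroup.zpowers (x : G ⧸ M)).comap (QuotientGroup.mk' M) :=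
        Subgroup.mem_zpowers (x : G ⧸ M)
      rw [← h] at hx
      rw [(QuotientGroup.eq_one_iff x).mpr hx, orderOf_one] at hy
      exact hq.one_lt.ne hy
  have htop := hM.2 _ hlt
  rw [← Subgroup.comap_top (QuotientGroup.mk' M)] at htop
  have htop' := Subgroup.comap_injective (QuotientGroup.mk'_surjective M) htop
  have : M.index = q := by
    rw [Subgroup.index, ← Subgroup.card_top, ← htop', Nat.card_zpowers, hy]
  rwa [this]

/-- If an element of prime order `p` lies outside a normal subgroup of index `p` of a
semiprime-cyclic group, then the order of the subgroup is prime to `p`. -/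
theorem IsSemiprimeCyclic.not_dvd_card {G : Type*} [Group G] [Finite G]
    (h : IsSemiprimeCyclic G) {p : ℕ} (hp : p.Prime) {M : Subgroup G} [M.Normal]
    (hindex : M.index = p) {g : G} (hg : orderOf g = p) (hgM : g ∉ M) : ¬ p ∣ Nat.card M := by
  intro hd
  have := Fact.mk hp
  have hpg : IsPGroup p (Subgroup.zpowers g) := IsPGroup.of_card (n := 1) (by
    rw [Nat.card_zpowers, hg, pow_one])
  obtain ⟨P, hP⟩ := hpg.exists_le_sylow
  have hgP : g ∈ (P : Subgroup G) := hP (Subgroup.mem_zpowers g)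
  have hp2 : p ^ 2 ∣ Nat.card P := by
    refine P.pow_dvd_card_of_pow_dvd_card ?_
    rw [← M.card_mul_index, hindex, sq]
    exact mul_dvd_mul_right hd p
  -- The index of `M ⊓ P` in `P` divides `p`, while `p ^ 2` divides the order of `P`. The only
  -- subgroup of order `p` in `P` then lies in `M` and contains `g`.
  have hne : M ⊓ P ≠ ⊥ := by
    intro hbot
    have h1 : M.relIndex P ∣ M.index := Subgroup.relIndex_dvd_index_of_normal M P
    rw [← Subgroup.inf_relIndex_right, hbot, Subgroup.relIndex_bot_left, hindex] at h1
    have h2 := Nat.le_of_dvd hp.pos (hp2.trans h1)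
    have := hp.one_lt
    nlinarith
  have hPne : (P : Subgroup G) ≠ ⊥ := fun hbot => hne (by rw [hbot, inf_bot_eq])
  obtain ⟨z, -, hz, huniq⟩ := h.exists_unique_order hp P.isPGroup' hPne
  obtain ⟨y, hyMP, hy, -⟩ := h.exists_unique_order hp
    (P.isPGroup'.to_le (inf_le_right : M ⊓ P ≤ P)) hne
  have hyz := huniq y hyMP.2 (by rw [← hy, pow_orderOf_eq_one])
  have hgz := huniq g hgP (by rw [← hg, pow_orderOf_eq_one])
  have heq : Subgroup.zpowers y = Subgroup.zpowers z :=
    Subgroup.eq_of_le_of_card_ge (by simpa using hyz) (by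
      rw [Nat.card_zpowers, Nat.card_zpowers, hz, hy])
  rw [← heq] at hgz
  exact hgM ((by simpa using hyMP.1 : Subgroup.zpowers y ≤ M) hgz)

/-- In a free representation the units of a quaternion triple give rise to an operator of order
three without fixed vectors that induces the automorphism of the triple. -/
theorem QuaternionTriple.exists_operator {M V : Type*} [Group M] [AddCommGroup V] [Module ℂ V]
    {ρ : Representation ℂ M V} (hρ : IsFreeRepresentation ρ) {σ : MulAut M} {z i j k : M}
    (h : QuaternionTriple σ z i j k)
    (hM : ∀ m, ∃ a c, IsQuaternionUnit z i j k a ∧ m = a * c ∧ Commute c i ∧ Commute c j ∧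
      σ c = c) :
    ∃ T : Module.End ℂ V, T ^ 3 = 1 ∧ (∀ v, T v = v → v = 0) ∧
      ∀ m, T * ρ m = ρ (σ m) * T := by
  -- The vector `v + ρ z v` is fixed by `z`, so it vanishes by freeness.
  have hz : ρ z = -1 := by
    ext v
    have h1 : ρ z (v + ρ z v) = v + ρ z v := by
      rw [map_add, ← Module.End.mul_apply, ← map_mul, h.z_sq, map_one, Module.End.one_apply,
        add_comm]
    have h2 : v + ρ z v = 0 := by
      by_contra hne
      exact hρ.2 z h.z_ne _ hne h1
    rw [LinearMap.neg_apply, Module.End.one_apply]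
    exact (neg_eq_of_add_eq_zero_right h2).symm
  have key : ∀ {i j k : M}, QuaternionTriple σ z i j k → ρ i * ρ i = -1 ∧ ρ i * ρ j = ρ k ∧
      ρ j * ρ i = -ρ k := by
    intro i j k h
    refine ⟨?_, ?_, ?_⟩
    · rw [← map_mul, h.i_sq, hz]
    · rw [← map_mul, h.i_mul_j]
    · rw [← map_mul, h.j_mul_i, map_mul, hz, mul_neg_one]
  obtain ⟨ii, ij, ji⟩ := key h
  obtain ⟨jj, jk, kj⟩ := key h.rotate
  obtain ⟨kk, ki, ik⟩ := key h.rotate.rotate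
  set I := ρ i with hI
  set J := ρ j with hJ
  set K := ρ k with hK
  let S : Module.End ℂ V := I + J + K
  have hS : S * S = (-3 : ℂ) • 1 := by
    simp only [S, mul_add, add_mul, ii, ij, ik, ji, jj, jk, ki, kj, kk]
    module
  -- A Hurwitz unit: `(1 + i + j + k) / 2` has order six and conjugation by it rotates `i, j, k`;
  -- the minus sign makes the order three. From `T ^ 2 + T + 1 = 0`, a fixed vector `v` satisfies `3
  -- • v = 0`.
  let T : Module.End ℂ V := (-(1 / 2) : ℂ) • (1 + S)
  have hT2 : T * T = -1 - T := by
    simp only [T, smul_mul_assoc, mul_smul_comm, mul_add, add_mul, one_mul, mul_one, hS]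
    module
  have hTI : T * I = J * T := by
    simp only [T, S, smul_mul_assoc, mul_smul_comm, mul_add, add_mul, one_mul, mul_one,
      ii, ji, ki, jj, jk]
    module
  have hTJ : T * J = K * T := by
    simp only [T, S, smul_mul_assoc, mul_smul_comm, mul_add, add_mul, one_mul, mul_one,
      ij, jj, kj, ki, kk]
    module
  refine ⟨T, ?_, ?_, ?_⟩
  · rw [pow_succ, sq, hT2, sub_mul, hT2]
    noncomm_ring
  · intro v hv
    have h1 := congrArg (fun A : Module.End ℂ V => A v) hT2
    simp only [Module.End.mul_apply, LinearMap.sub_apply, LinearMap.neg_apply,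
      Module.End.one_apply, hv] at h1
    have h2 : (3 : ℂ) • v = 0 := by
      have : (3 : ℂ) • v = v - (-v - v) := by module
      rw [this, ← h1, sub_self]
    exact (smul_eq_zero.mp h2).resolve_left (by norm_num)
  · have hmul : ∀ a b, T * ρ a = ρ (σ a) * T → T * ρ b = ρ (σ b) * T →
        T * ρ (a * b) = ρ (σ (a * b)) * T := by
      intro a b ha hb
      rw [map_mul, map_mul, map_mul, ← mul_assoc, ha, mul_assoc, hb, mul_assoc]
    have hi : T * ρ i = ρ (σ i) * T := by rw [h.map_i]; exact hTI
    have hj : T * ρ j = ρ (σ j) * T := by rw [h.map_j]; exact hTJ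
    have hk : T * ρ k = ρ (σ k) * T := by rw [← h.i_mul_j]; exact hmul i j hi hj
    have hzT : T * ρ z = ρ (σ z) * T := by rw [← h.i_sq]; exact hmul i i hi hi
    have h1 : T * ρ 1 = ρ (σ 1) * T := by simp
    intro m
    obtain ⟨a, c, ⟨b, hb, hab⟩, rfl, hci, hcj, hc⟩ := hM m
    have hck : Commute c k := by rw [← h.i_mul_j]; exact hci.mul_right hcj
    have hcT : T * ρ c = ρ (σ c) * T := by
      have e1 : I * ρ c = ρ c * I := (hci.map ρ).eq.symm
      have e2 : J * ρ c = ρ c * J := (hcj.map ρ).eq.symm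
      have e3 : K * ρ c = ρ c * K := (hck.map ρ).eq.symm
      simp only [T, S, hc, smul_mul_assoc, mul_smul_comm, mul_add, add_mul, one_mul, mul_one,
        e1, e2, e3]
    have hbT : T * ρ b = ρ (σ b) * T := by
      rcases hb with rfl | rfl | rfl | rfl
      exacts [h1, hi, hj, hk]
    refine hmul a c ?_ hcT
    rcases hab with rfl | rfl
    · exact hbT
    · exact hmul b z hbT hzT

/-- The space is kept in the universe of the group, so that coinduction, which uses functions on
`G`, does not leave it during the induction. -/
theorem IsSemiprimeCyclic.isFreelyRepresentable_aux.{u} (n : ℕ) : ∀ (G : Type u) [Group G]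
    [Finite G] [Group.IsSolvable G], Nat.card G = n → IsSemiprimeCyclic G →
      IsFreelyRepresentable.{u} G := by
  induction n using Nat.strong_induction_on with
  | _ n ih =>
    intro G _ _ _ hn h
    rcases subsingleton_or_nontrivial G with hG | hG
    · exact ⟨ULift.{u} ℂ, inferInstance, inferInstance, Representation.trivial ℂ G _,
        inferInstance, fun g hg => absurd (Subsingleton.elim g 1) hg⟩
    obtain ⟨M, hnormal, hp⟩ := exists_normal_index_prime G
    obtain ⟨p, hindex⟩ : ∃ p, M.index = p := ⟨_, rfl⟩
    rw [hindex] at hp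
    have hcard := M.card_mul_index
    rw [hindex] at hcard
    have hlt : Nat.card M < n := by
      rw [← hn, ← hcard]
      exact lt_mul_of_one_lt_right Nat.card_pos hp.one_lt
    obtain ⟨V, _, _, ρ, hρ⟩ := ih _ hlt M rfl (h.subgroup M)
    by_cases hall : ∀ g : G, (orderOf g).Prime → g ∈ M
    · exact ⟨_, _, _, _, hρ.coind hall⟩
    push Not at hall
    obtain ⟨g, hgprime, hgM⟩ := hall
    have hg : orderOf g = p := by
      have h2 : g ^ p ∈ M := by
        rw [← hindex]
        exact M.pow_index_mem g
      rcases (Nat.coprime_or_dvd_of_prime hgprime p) with h3 | h3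
      · exfalso
        apply hgM
        have : g ∈ Subgroup.zpowers (g ^ p) := by
          rw [mem_zpowers_pow_iff]
          exact h3.symm
        exact (by simpa using h2 : Subgroup.zpowers (g ^ p) ≤ M) this
      · exact (Nat.prime_dvd_prime_iff_eq hgprime hp).mp h3
    have hpM := h.not_dvd_card hp hindex hg hgM
    have hσ : (MulAut.conjNormal g : MulAut M) ^ p = 1 := by
      rw [← map_pow, ← hg, pow_orderOf_eq_one, map_one]
    have hfix : ∀ x : M, (orderOf x).Prime →
        (MulAut.conjNormal g : MulAut M) x ∈ Subgroup.zpowers x →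
        (MulAut.conjNormal g : MulAut M) x = x := by
      intro x hx hgx
      have hne : p ≠ orderOf x := by
        rintro h1
        exact hpM (h1 ▸ orderOf_dvd_natCard x)
      have hc := h.commute_of_conj_mem hp hx hne hg (Subgroup.orderOf_coe x) (by
        obtain ⟨m, hm⟩ := hgx
        refine ⟨m, ?_⟩
        have := congrArg Subtype.val hm
        simpa using this)
      ext
      rw [MulAut.conjNormal_apply, hc.eq, mul_inv_cancel_right]
    rcases (h.subgroup M).eq_one_or_quaternion hp hσ hpM hfix with
      h1 | ⟨rfl, z, i, j, k, hT, hM⟩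
    -- Here `g` centralizes `M`, so it may act by a scalar, a primitive `p`-th root of unity.
    · have hζ := Complex.isPrimitiveRoot_exp p hp.ne_zero
      set ζ := Complex.exp (2 * Real.pi * Complex.I / p)
      refine hρ.isFreelyRepresentable_of_extension hp hindex hpM hg (T := ζ • 1) ?_ ?_ ?_
      · rw [smul_pow, one_pow, hζ.pow_eq_one, one_smul]
      · intro v hv
        rw [LinearMap.smul_apply, Module.End.one_apply] at hv
        have h2 : (ζ - 1) • v = 0 := by rw [sub_smul, one_smul, hv, sub_self]
        exact (smul_eq_zero.mp h2).resolve_left (sub_ne_zero.mpr (hζ.ne_one hp.one_lt))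
      · intro m
        rw [h1, MulAut.one_apply, smul_mul_assoc, mul_smul_comm, one_mul, mul_one]
    · obtain ⟨T, hT3, hTfix, hTconj⟩ := hT.exists_operator hρ hM
      exact hρ.isFreelyRepresentable_of_extension hp hindex hpM hg hT3 hTfix hTconj

theorem mainTheorem2 (G : Type*) [Group G] [Finite G] [Group.IsSolvable G] :
    IsSemiprimeCyclic G ↔ IsFreelyRepresentable.{w} G :=
  ⟨fun h => (IsSemiprimeCyclic.isFreelyRepresentable_aux _ G rfl h).change_universe,
    fun h => h.isSemiprimeCyclic⟩

end MainTheorem
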